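/- Let $K$ be a field, $V$ a finite-dimensional $K$-vector space and $S=\operatorname{Sym}V$ the homogeneous coordinate ring of $\mathbb P(V)$, so that linear forms on $\mathbb P(V)$ are elements of $V$ and points are nonzero functionals $x\in V^*$ up to scalars. Let $X\subset\mathbb P(V)$ be a closed subscheme (for example a possibly reducible variety) whose homogeneous ideal $I=I_X\subset S$ is generated by quadrics; in particular $X$ is nondegenerate. Let $0\leftarrow I\leftarrow F_0\leftarrow F_1\leftarrow\cdots$ be a minimal graded free resolution by free $S$-modules of finite rank, let $V_p\otimes S(-p-2)$ be the summand of $F_p$ generated in degree $p+2$ (the linear strand), and let $\tilde\varphi\colon V_p\to V_{p-1}\otimes V$ be the map induced by the differential ($p\ge1$). Identify $V_p\cong\ker(\Lambda^pV\otimes I_2\to\Lambda^{p-1}V\otimes I_3)$ by the natural isomorphisms $\theta_p$, where $\theta_0$ is $V_0\cong I_2$ and $\theta_p$ is determined by $\Delta\circ\theta_p=\theta_{p-1}\circ\tilde\varphi$, with $\Delta\colon\Lambda^pV\to V\otimes\Lambda^{p-1}V$ the comultiplication. Let $p\ge1$, and let $0\ne s\in V_p$ be a $p$-th linear syzygy of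 $X$. Let $L_s\subset V$ be the space of linear forms involved in $s$, i.e. the image of $\tilde\varphi(s)\in V_{p-1}\otimes V\cong\operatorname{Hom}(V_{p-1}^*,V)$, and let $r=\dim L_s$. Let $\operatorname{Syz}(s)\subset\mathbb P(V)$ be the scheme whose ideal is generated by the quadrics $Q_\alpha$ in $s=\sum_\alpha v_\alpha\otimes Q_\alpha$, where $(v_\alpha)$ is a basis of $\Lambda^pV$. For a vector space $L$ of dimension $r\ge p+1$, let $$\operatorname{Gensyz}_p(L)=\{(l^*,a^*)\in L^*\oplus\Lambda^{r-p-1}L^*\mid l^*\wedge a^*=0\}\subset\mathbb P(L\oplus\Lambda^{r-p-1}L)$$ be the scheme defined by the coordinates of $l^*\wedge a^*$. A generic $p$-th syzygy of $\operatorname{Gensyz}_p(L)$ is a $p$-th syzygy $s_{gen}$ of it, i.e. an element of $\ker(\Lambda^pE\otimes J_2\to\Lambda^{p-1}E\otimes J_3)$ with $E=L\oplus\Lambda^{r-p-1}L$ and $J$ the ideal generated by these coordinates, that is the image of a nonzero element of $\Lambda^rL$ under $$\Lambda^rL\to\Lambda^pL\otimes(L\otimes\Lambda^{r-p-1}L)\to\Lambda^pE\otimes\operatorname{Sym}^2E.$$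 Then $r\ge p+1$, and there exist a linear map $\pi^*\colon L_s\oplus\Lambda^{r-p-1}L_s\to V$ and a generic $p$-th syzygy $s_{gen}$ of $\operatorname{Gensyz}_p(L_s)$ such that $$s=\pi^*(s_{gen}),$$ where $\pi^*$ also denotes the induced map $\Lambda^pE\otimes\operatorname{Sym}^2E\to\Lambda^pV\otimes\operatorname{Sym}^2V$ for $E=L_s\oplus\Lambda^{r-p-1}L_s$. Moreover, let $\pi\colon\mathbb P(V)\dashrightarrow\mathbb P^n=\mathbb P(\operatorname{im}\pi^*)\subset\mathbb P(L_s\oplus\Lambda^{r-p-1}L_s)$ be the linear projection corresponding to $\pi^*$. Then $$\operatorname{Syz}(s)=\pi^{-1}\bigl(\mathbb P^n\cap\operatorname{Gensyz}_p(L_s)\bigr).$$ Here the inverse image is understood as the cone including the center of $\pi$. The equality holds scheme-theoretically: the ideal generated by the $Q_\alpha$ is the extension to $S$ of the ideal of $\mathbb P^n\cap\operatorname{Gensyz}_p(L_s)$ in $\operatorname{Sym}(\operatorname{im}\pi^*)$. In particular, all $Q_\alpha$ vanish at $x\in V^*$ if and only if $l^*\wedge a^*=0$ for $(l^*,a^*)=x\circ\pi^*$.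 -/

import Mathlib

open scoped TensorProduct

noncomputable section

namespace LinearSyzygy

/-! ### Multilinear algebra -/

section Multilinear

variable {K : Type*} [Field K] {M N : Type*} [AddCommGroup M] [Module K M]
  [AddCommGroup N] [Module K N]

/-- The exterior product `l ∧ a` of a linear form `l` and an alternating `q`-form `a` on `M`, with
values in a commutative `K`-algebra `A`:
`(l ∧ a)(v₀, …, v_q) = ∑ i, (-1)^i * l (v_i) * a (v₀, …, v_{i-1}, v_{i+1}, …, v_q)`.
For `A = K` this is the exterior product `M^* × Λ^q M^* → Λ^{q+1} M^*`. -/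
def wedge {A : Type*} [CommRing A] [Algebra K A] {q : ℕ} (l : M →ₗ[K] A)
    (a : M [⋀^Fin q]→ₗ[K] A) : M [⋀^Fin (q + 1)]→ₗ[K] A :=
  AlternatingMap.alternatizeUncurryFin
    { toFun := fun v => (LinearMap.mulLeft K (l v)).compAlternatingMap a
      map_add' := fun v w => by ext; simp [add_mul]
      map_smul' := fun c v => by ext; simp }

/-- The comultiplication `Λ^{p+q} M → Λ^p M ⊗ Λ^q M` of the exterior algebra: the sum, with signs,
over all `(p, q)`-shuffles. -/
def comul (K : Type*) [Field K] (M : Type*) [AddCommGroup M] [Module K M] (p q : ℕ) :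
    ⋀[K]^(p + q) M →ₗ[K] ⋀[K]^p M ⊗[K] ⋀[K]^q M :=
  exteriorPower.alternatingMapLinearEquiv (R := K) (M := M) (n := p + q)
    (N := ⋀[K]^p M ⊗[K] ⋀[K]^q M)
    (AlternatingMap.domDomCongr finSumFinEquiv
      (AlternatingMap.domCoprod (exteriorPower.ιMulti K p (M := M))
        (exteriorPower.ιMulti K q (M := M))))

/-- The comultiplication `Λ^{q+1} M → M ⊗ Λ^q M`,
`v₀ ∧ … ∧ v_q ↦ ∑ i, (-1)^i v_i ⊗ (v₀ ∧ … ∧ v_{i-1} ∧ v_{i+1} ∧ … ∧ v_q)`. -/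
def comulOne (K : Type*) [Field K] (M : Type*) [AddCommGroup M] [Module K M] (q : ℕ) :
    ⋀[K]^(q + 1) M →ₗ[K] M ⊗[K] ⋀[K]^q M :=
  exteriorPower.alternatingMapLinearEquiv
    (AlternatingMap.alternatizeUncurryFin
      { toFun := fun v =>
          (TensorProduct.mk K M (⋀[K]^q M) v).compAlternatingMap (exteriorPower.ιMulti K q)
        map_add' := fun v w => by ext; simp
        map_smul' := fun c v => by ext; simp [TensorProduct.smul_tmul'] })

/-- An element of `M ⊗ N`, interpreted as a linear map `M^* → N`. -/
def toHom (t : M ⊗[K] N) : Module.Dual K M →ₗ[K] N :=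
  (TensorProduct.lid K N).toLinearMap ∘ₗ LinearMap.applyₗ t ∘ₗ LinearMap.rTensorHom N

/-- The ring homomorphism `Sym M → Sym N` induced by a linear map `M → N`. -/
def symMap (f : M →ₗ[K] N) : SymmetricAlgebra K M →ₐ[K] SymmetricAlgebra K N :=
  SymmetricAlgebra.lift (SymmetricAlgebra.ι K N ∘ₗ f)

end Multilinear

/-! ### Homogeneous ideals in `S = Sym V`, the homogeneous coordinate ring of `ℙ(V)`

A linear form on `ℙ(V)` is an element of `V`; a point of `ℙ(V)` is a nonzero element of `V^*`, up to
scalars. -/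

section Ideals

variable {K : Type*} [Field K] {V : Type*} [AddCommGroup V] [Module K V]

/-- The space `S_d = Sym^d V` of forms of degree `d`. -/
def forms (K : Type*) [Field K] (V : Type*) [AddCommGroup V] [Module K V] (d : ℕ) :
    Submodule K (SymmetricAlgebra K V) :=
  (LinearMap.range (SymmetricAlgebra.ι K V)) ^ d

/-- The space `I_2` of quadrics in the ideal `I`. -/
def quadrics (I : Ideal (SymmetricAlgebra K V)) : Submodule K (SymmetricAlgebra K V) :=
  I.restrictScalars K ⊓ forms K V 2

/-- `I` is generated by quadrics. In particular `I` is homogeneous and contains no linear form,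
i.e. the subscheme of `ℙ(V)` that it defines is nondegenerate. -/
def GeneratedByQuadrics (I : Ideal (SymmetricAlgebra K V)) : Prop :=
  Ideal.span (quadrics I : Set (SymmetricAlgebra K V)) = I

/-- The Koszul differential `Λ^{p+1} V ⊗ S → Λ^p V ⊗ S`. -/
def koszulD (K : Type*) [Field K] (V : Type*) [AddCommGroup V] [Module K V] (p : ℕ) :
    ⋀[K]^(p + 1) V ⊗[K] SymmetricAlgebra K V →ₗ[K] ⋀[K]^p V ⊗[K] SymmetricAlgebra K V :=
  (TensorProduct.lift
      ((LinearMap.mul K (SymmetricAlgebra K V)) ∘ₗ SymmetricAlgebra.ι K V)).lTensor (⋀[K]^p V) ∘ₗ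
    (TensorProduct.leftComm K V (⋀[K]^p V) (SymmetricAlgebra K V)).toLinearMap ∘ₗ
    (TensorProduct.assoc K V (⋀[K]^p V) (SymmetricAlgebra K V)).toLinearMap ∘ₗ
    (comulOne K V p).rTensor (SymmetricAlgebra K V)

/-- `ker (Λ^p V ⊗ I_2 → Λ^{p-1} V ⊗ I_3)`, as a subspace of `Λ^p V ⊗ S` (for `p = 0` there is no
condition besides the coefficients being in `I_2`). -/
def koszulSyzygies (I : Ideal (SymmetricAlgebra K V)) :
    (p : ℕ) → Submodule K (⋀[K]^p V ⊗[K] SymmetricAlgebra K V)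
  | 0 => LinearMap.range ((quadrics I).subtype.lTensor (⋀[K]^0 V))
  | p + 1 => LinearMap.range ((quadrics I).subtype.lTensor (⋀[K]^(p + 1) V)) ⊓
      LinearMap.ker (koszulD K V p)

/-- The ideal of the vanishing scheme of `σ = ∑ v_α ⊗ Q_α ∈ Λ^p V ⊗ S_2`: it is generated by the
coefficients `Q_α` of `σ` (for one, or equivalently every, basis `v_α` of `Λ^p V`). -/
def syzIdeal {p : ℕ} (σ : ⋀[K]^p V ⊗[K] SymmetricAlgebra K V) : Ideal (SymmetricAlgebra K V) :=
  Ideal.span (LinearMap.range (toHom σ) : Set (SymmetricAlgebra K V))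

end Ideals

/-! ### The linear strand of a minimal free resolution -/

section Resolution

variable {K : Type*} [Field K] {V : Type*} [AddCommGroup V] [Module K V]

/-- A minimal graded free resolution `0 ← I ← F_0 ← F_1 ← ⋯` of the ideal `I ⊆ S`, in homogeneous
bases: `F_i` is free of finite rank `rank i`, its `b`-th basis element has degree `deg i b`, the map
`F_0 → I` sends the `c`-th basis element to `gen c`, and the map `F_{i+1} → F_i` sends the `b`-th
basis element to the `b`-th row of the matrix `d i`. -/
structure MinimalResolution (I : Ideal (SymmetricAlgebra K V)) where
  rank : ℕ → ℕ
  deg : (i : ℕ) → Fin (rank i) → ℕ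
  gen : Fin (rank 0) → SymmetricAlgebra K V
  d : (i : ℕ) → Matrix (Fin (rank (i + 1))) (Fin (rank i)) (SymmetricAlgebra K V)
  gen_mem : ∀ c, gen c ∈ forms K V (deg 0 c)
  /-- The differentials are homogeneous of degree `0`, ... -/
  d_mem : ∀ i b c, d i b c ∈ forms K V (deg (i + 1) b - deg i c)
  /-- ... and minimal: every nonzero entry has positive degree. -/
  minimal : ∀ i b c, d i b c ≠ 0 → deg i c < deg (i + 1) b
  span_gen : Ideal.span (Set.range gen) = I
  exact_zero : ∀ x : Fin (rank 0) → SymmetricAlgebra K V,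
    ∑ c, x c * gen c = 0 ↔ ∃ y, x = Matrix.vecMul y (d 0)
  exact_succ : ∀ (i : ℕ) (x : Fin (rank (i + 1)) → SymmetricAlgebra K V),
    Matrix.vecMul x (d i) = 0 ↔ ∃ y, x = Matrix.vecMul y (d (i + 1))

/-- The vector `v ∈ V` that is the linear form `x ∈ S_1 ≅ V`. -/
def linearForm (x : SymmetricAlgebra K V) : V :=
  Function.invFun (SymmetricAlgebra.ι K V) x

namespace MinimalResolution

variable {I : Ideal (SymmetricAlgebra K V)} (F : MinimalResolution I)

/-- The basis elements of `F_p` of degree `p + 2`. -/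
abbrev StrandIndex (p : ℕ) : Type := {b : Fin (F.rank p) // F.deg p b = p + 2}

/-- The space `V_p` of `p`-th linear syzygies: `V_p ⊗ S(-p-2)` is the degree `p + 2` summand of
`F_p`, i.e. the `p`-th term of the linear strand. -/
abbrev Strand (p : ℕ) : Type _ := F.StrandIndex p → K

/-- The map `φ̃ : V_{p+1} → V_p ⊗ V` of vector spaces induced by the linear strand. -/
def strandMap (p : ℕ) : F.Strand (p + 1) →ₗ[K] F.Strand p ⊗[K] V :=
  ∑ b : F.StrandIndex (p + 1), ∑ c : F.StrandIndex p,
    (LinearMap.proj b : F.Strand (p + 1) →ₗ[K] K).smulRight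
      ((Pi.single c (1 : K) : F.Strand p) ⊗ₜ[K] linearForm (F.d p b.1 c.1))

/-- The space `L_s ⊆ V` of linear forms involved in the `p`-th syzygy `s`, `p ≥ 1`: the image of
`φ̃(s) ∈ V_{p-1} ⊗ V ≅ Hom(V_{p-1}^*, V)`. (It is not used for `p = 0`.) -/
def involvedForms : (p : ℕ) → F.Strand p → Submodule K V
  | 0, _ => ⊥
  | p + 1, s => LinearMap.range (toHom (F.strandMap p s))

/-- `σ ∈ Λ^p V ⊗ S` corresponds to the `p`-th syzygy `s ∈ V_p` under the natural isomorphism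
`θ_p : V_p ≅ ker (Λ^p V ⊗ I_2 → Λ^{p-1} V ⊗ I_3)`. These isomorphisms are determined by comparing
the linear strand with the Koszul complex: `θ_0` sends a basis element of `V_0` to the quadric in
`I_2` that it represents, and `θ_{p+1}` is the unique map with
`(Λ^{p+1} V → V ⊗ Λ^p V) ∘ θ_{p+1} = θ_p ∘ φ̃`. -/
def Corresponds : (p : ℕ) → F.Strand p → ⋀[K]^p V ⊗[K] SymmetricAlgebra K V → Prop
  | 0, s, σ => σ = (exteriorPower.zeroEquiv K V).symm 1 ⊗ₜ[K]
      ∑ c : F.StrandIndex 0, s c • F.gen c.1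
  | p + 1, s, σ => ∃ θ : F.Strand p →ₗ[K] ⋀[K]^p V ⊗[K] SymmetricAlgebra K V,
      (∀ t, Corresponds p t (θ t)) ∧
      TensorProduct.assoc K V (⋀[K]^p V) (SymmetricAlgebra K V)
          ((comulOne K V p).rTensor (SymmetricAlgebra K V) σ) =
        TensorProduct.comm K _ V (θ.rTensor V (F.strandMap p s))

end MinimalResolution

end Resolution

/-! ### Generic syzygy schemes -/

section Generic

variable (K : Type*) [Field K] (L : Type*) [AddCommGroup L] [Module K L]

/-- The (affine cone over the) set of points of the generic syzygy scheme
`{(l, a) ∈ L^* ⊕ Λ^q L^* | l ∧ a = 0}`, where `q = r - p - 1`. -/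
def gensyzPoints (q : ℕ) : Set (Module.Dual K L × (L [⋀^Fin q]→ₗ[K] K)) :=
  {x | wedge x.1 x.2 = 0}

/-- The ideal of the generic syzygy scheme `{l ∧ a = 0} ⊆ ℙ(L ⊕ Λ^q L)`, where `q = r - p - 1`: it
is generated by the coordinates of `l ∧ a` for the universal point `(l, a)`, that is, `l` and `a`
are the inclusions of `L` and `Λ^q L` into `Sym (L ⊕ Λ^q L)`. -/
def gensyzIdeal (q : ℕ) : Ideal (SymmetricAlgebra K (L × ⋀[K]^q L)) :=
  Ideal.span (Set.range (wedge (K := K) (M := L)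
    (SymmetricAlgebra.ι K (L × ⋀[K]^q L) ∘ₗ LinearMap.inl K L (⋀[K]^q L))
    ((SymmetricAlgebra.ι K (L × ⋀[K]^q L) ∘ₗ LinearMap.inr K L (⋀[K]^q L)).compAlternatingMap
      (exteriorPower.ιMulti K q))))

/-- The map `L ⊗ Λ^q L → Sym^2 (L ⊕ Λ^q L)`. -/
def mixedProduct (q : ℕ) : L ⊗[K] ⋀[K]^q L →ₗ[K] SymmetricAlgebra K (L × ⋀[K]^q L) :=
  LinearMap.mul' K _ ∘ₗ TensorProduct.map
    (SymmetricAlgebra.ι K (L × ⋀[K]^q L) ∘ₗ LinearMap.inl K L (⋀[K]^q L))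
    (SymmetricAlgebra.ι K (L × ⋀[K]^q L) ∘ₗ LinearMap.inr K L (⋀[K]^q L))

/-- The image of an element of `Λ^r L`, `r = p + (q + 1)`, under
`Λ^r L → Λ^p L ⊗ (L ⊗ Λ^q L) ⊆ Λ^p (L ⊕ Λ^q L) ⊗ Sym^2 (L ⊕ Λ^q L)`. -/
def genericSyzygy (p q : ℕ) : ⋀[K]^(p + (q + 1)) L →ₗ[K]
    ⋀[K]^p (L × ⋀[K]^q L) ⊗[K] SymmetricAlgebra K (L × ⋀[K]^q L) :=
  TensorProduct.map (exteriorPower.map p (LinearMap.inl K L (⋀[K]^q L)))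
      (mixedProduct K L q ∘ₗ comulOne K L q) ∘ₗ
    comul K L p (q + 1)

variable {K L}

/-- `g` is a generic `p`-th syzygy of the generic syzygy scheme of the vector space `L` of dimension
`r = p + (q + 1)`: it is a `p`-th syzygy of that scheme, and it is given by an orientation of `L`,
a nonzero element of the line `Λ^r L`. -/
def IsGenericSyzygy {p q : ℕ}
    (g : ⋀[K]^p (L × ⋀[K]^q L) ⊗[K] SymmetricAlgebra K (L × ⋀[K]^q L)) : Prop :=
  g ∈ koszulSyzygies (gensyzIdeal K L q) p ∧
    ∃ o : ⋀[K]^(p + (q + 1)) L, o ≠ 0 ∧ g = genericSyzygy K L p q o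

end Generic

/-! ### The projection `π` defined by a linear map `π^* : E → V` -/

section Projection

variable {K : Type*} [Field K] {E V : Type*} [AddCommGroup E] [Module K E]
  [AddCommGroup V] [Module K V]

/-- The map `Λ^p E ⊗ Sym E → Λ^p V ⊗ Sym V` induced by `f = π^* : E → V`. -/
def inducedMap (f : E →ₗ[K] V) (p : ℕ) :
    ⋀[K]^p E ⊗[K] SymmetricAlgebra K E →ₗ[K] ⋀[K]^p V ⊗[K] SymmetricAlgebra K V :=
  TensorProduct.map (exteriorPower.map p f) (symMap f).toLinearMap

/-- The ideal, in the coordinate ring `Sym (im π^*)` of the linear subspace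
`ℙ^n = ℙ(im π^*) ⊆ ℙ(E)`, of the intersection of `ℙ^n` with the subscheme of `ℙ(E)` defined by
`J`. -/
def linearSection (f : E →ₗ[K] V) (J : Ideal (SymmetricAlgebra K E)) :
    Ideal (SymmetricAlgebra K (LinearMap.range f)) :=
  J.map (symMap f.rangeRestrict)

/-- The ideal of the inverse image (the cone over the center of `π`, which it contains) in `ℙ(V)`,
under the linear projection `π : ℙ(V) ⇢ ℙ^n = ℙ(im π^*)`, of the subscheme of `ℙ^n` defined by
`J`. -/
def coneOver (f : E →ₗ[K] V) (J : Ideal (SymmetricAlgebra K (LinearMap.range f))) :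
    Ideal (SymmetricAlgebra K V) :=
  J.map (symMap (LinearMap.range f).subtype)

end Projection

end LinearSyzygy

end

open LinearSyzygy

/-!
Over a finite-dimensional `V`, the space `Λ^n V ⊗ N` is the space of alternating `n`-forms on `V^*`
with values in `N` (`toForm_bijective`). The whole argument is carried out with these forms: the
comultiplication becomes the insertion of a first argument, and the Koszul differential becomes
`B ↦ ∑ i, e_i * B (e_i^*, ·)` (`toForm_koszulD`).

*Comparison with the Koszul complex.* The comparison map `θ_p` sends `s` to the form obtained by
contracting the strand map `p` times by the arguments. The form is alternating because the linear
strand is a complex (`contract_contract_self`), and it is a Koszul cycle because the differential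
`F_1 → F_0` consists of relations between the generators. Since `I` contains no forms of degree less
than two, minimality shows that no nonzero linear syzygy is killed by all contractions, so `θ_p` is
injective. The syzygy `σ = θ_p(s)` vanishes as soon as one argument vanishes on `L = L_s`; it is
therefore a form on `L^*` (`exists_corresponds`).

*Exactness.* As a form on `L^*`, `σ` is a cycle in the Koszul complex of a basis `x_i` of `L`, which
is part of a system of variables of `S`. In each variable there is the homotopy
`A ↦ e_i ∧ (A / x_i)`, and eliminating the variables one by one shows that the Koszul complex is
exact (`exists_koszulForm_eq`). Hence `σ(d) = ± ∑ i, x_i * T (x_i^*, d)` for an alternating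
`(p + 1)`-form `T` on `L^*` with values in `V`. As `σ ≠ 0` also `T ≠ 0`, so `dim L ≥ p + 1`.

*The projection.* Let `q = dim L - p - 1`. A nonzero `o ∈ Λ^{p+1+q} L` identifies `Λ^{p+1} L^*` with
`Λ^q L` (`contractTop_bijective`), and so turns `T` into a linear map `a : Λ^q L → V`. By
coassociativity, the formula for `σ` says precisely that `σ` is the image of the generic syzygy
given by `o` under `π^* = (inclusion, a)` (`exists_toForm_eq_mulMap`). Finally, the contractions of
`o` by products of `p` linear forms span `Λ^{q+1} L`; the coefficients of `σ` therefore span the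
same space as the coefficients of `l ∧ a`, which generate the ideal of the cone over the generic
syzygy scheme (`range_toHom_eq_range_mulMap`, `coneOver_gensyzIdeal`).
-/

namespace LinearSyzygy

open Module

/-! ### Tensors as linear maps, and elements of `Λ^n M ⊗ N` as alternating forms -/

section ToHom
variable {K : Type*} [Field K] {M N P : Type*} [AddCommGroup M] [Module K M]
  [AddCommGroup N] [Module K N] [AddCommGroup P] [Module K P]

@[simp]
lemma toHom_tmul (v : M) (n : N) (d : Dual K M) : toHom (v ⊗ₜ[K] n) d = d v • n := by
  simp [toHom]

lemma toHom_add (s t : M ⊗[K] N) : toHom (s + t) = toHom s + toHom t := by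
  ext; simp [toHom]

lemma toHom_smul (c : K) (t : M ⊗[K] N) : toHom (c • t) = c • toHom t := by
  ext; simp [toHom]

/-- `toHom` as a linear map in the tensor. -/
noncomputable def toHomLinear (K M N : Type*) [Field K] [AddCommGroup M] [Module K M]
    [AddCommGroup N] [Module K N] : M ⊗[K] N →ₗ[K] Dual K M →ₗ[K] N where
  toFun := toHom
  map_add' := toHom_add
  map_smul' := toHom_smul

@[simp]
lemma toHomLinear_apply (t : M ⊗[K] N) : toHomLinear K M N t = toHom t := rfl

lemma toHom_map {M' N' : Type*} [AddCommGroup M'] [Module K M'] [AddCommGroup N'] [Module K N']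
    (f : M →ₗ[K] M') (g : N →ₗ[K] N') (t : M ⊗[K] N) (d : Dual K M') :
    toHom (TensorProduct.map f g t) d = g (toHom t (d ∘ₗ f)) := by
  induction t with
  | zero => simp [← toHomLinear_apply]
  | tmul v n => simp
  | add s t hs ht => simp [toHom_add, hs, ht]

/-- A tensor is the sum of the products of the vectors of a basis with its contractions by the
dual basis. -/
lemma sum_tmul_toHom_coord {ι : Type*} [Fintype ι] (b : Basis ι K M) (t : M ⊗[K] N) :
    ∑ i, b i ⊗ₜ[K] toHom t (b.coord i) = t := by
  induction t with
  | zero => simp [← toHomLinear_apply]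
  | tmul v n =>
    simp only [toHom_tmul, TensorProduct.tmul_smul, TensorProduct.smul_tmul', Basis.coord_apply]
    rw [← TensorProduct.sum_tmul, b.sum_repr]
  | add s t hs ht => simp [toHom_add, TensorProduct.tmul_add, Finset.sum_add_distrib, hs, ht]

lemma toHom_bijective [FiniteDimensional K M] :
    Function.Bijective (toHom : M ⊗[K] N → Dual K M →ₗ[K] N) := by
  let b := finBasis K M
  refine ⟨fun s t h => ?_, fun f => ⟨∑ i, b i ⊗ₜ[K] f (b.coord i), ?_⟩⟩
  · rw [← sum_tmul_toHom_coord b s, ← sum_tmul_toHom_coord b t, h]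
  · ext d
    rw [← toHomLinear_apply, map_sum, LinearMap.sum_apply]
    simp only [toHomLinear_apply, toHom_tmul, ← map_smul, ← map_sum]
    congr 1
    refine b.ext fun j => ?_
    simp

end ToHom

section Pairing
variable {K : Type*} [Field K] {M : Type*} [AddCommGroup M] [Module K M]

/-- The exterior powers of the dual space are dual to the exterior powers. -/
lemma pairingDual_bijective [FiniteDimensional K M] (n : ℕ) :
    Function.Bijective (exteriorPower.pairingDual K M n) := by
  have hs : Function.Surjective (exteriorPower.pairingDual K M n) := by
    intro φ
    let b := (finBasis K M).exteriorPower n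
    refine ⟨∑ s, φ (b s) • exteriorPower.ιMulti_family K n (finBasis K M).coord s, ?_⟩
    refine b.ext fun s => ?_
    have h (t) : exteriorPower.pairingDual K M n
        (exteriorPower.ιMulti_family K n (finBasis K M).coord t) = b.coord t :=
      (exteriorPower.basis_coord K n (finBasis K M) t).symm
    simp [h]
  refine ⟨(LinearMap.injective_iff_surjective_of_finrank_eq_finrank ?_).2 hs, hs⟩
  rw [Subspace.dual_finrank_eq, exteriorPower.finrank_eq, exteriorPower.finrank_eq,
    Subspace.dual_finrank_eq]

/-- Elements of `Λ^n M` are separated by products of linear forms. -/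
lemma exteriorPower_ext [FiniteDimensional K M] {n : ℕ} {u w : ⋀[K]^n M}
    (h : ∀ d : Fin n → Dual K M, exteriorPower.alternatingMapToDual K M n d u =
      exteriorPower.alternatingMapToDual K M n d w) : u = w := by
  rw [← sub_eq_zero, ← Module.forall_dual_apply_eq_zero_iff K]
  intro φ
  obtain ⟨ξ, rfl⟩ := (pairingDual_bijective n).2 φ
  have : (exteriorPower.pairingDual K M n).flip (u - w) = 0 := by
    refine exteriorPower.linearMap_ext ?_
    ext d
    simp [exteriorPower.pairingDual, h]
  exact LinearMap.congr_fun this ξ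

end Pairing

section ToForm
variable {K : Type*} [Field K] {M N : Type*} [AddCommGroup M] [Module K M]
  [AddCommGroup N] [Module K N]

/-- An element of `Λ^n M ⊗ N`, interpreted as an alternating form on `M^*` with values in `N`. -/
noncomputable def toForm {n : ℕ} (t : ⋀[K]^n M ⊗[K] N) : (Dual K M) [⋀^Fin n]→ₗ[K] N :=
  (toHom t).compAlternatingMap (exteriorPower.alternatingMapToDual K M n)

lemma toForm_apply {n : ℕ} (t : ⋀[K]^n M ⊗[K] N) (d : Fin n → Dual K M) :
    toForm t d = toHom t (exteriorPower.alternatingMapToDual K M n d) := rfl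

@[simp]
lemma toForm_tmul {n : ℕ} (u : ⋀[K]^n M) (y : N) (d : Fin n → Dual K M) :
    toForm (u ⊗ₜ[K] y) d = exteriorPower.alternatingMapToDual K M n d u • y := by
  simp [toForm]

lemma toForm_add {n : ℕ} (s t : ⋀[K]^n M ⊗[K] N) : toForm (s + t) = toForm s + toForm t := by
  ext; simp [toForm, toHom_add]

lemma toForm_smul {n : ℕ} (c : K) (t : ⋀[K]^n M ⊗[K] N) : toForm (c • t) = c • toForm t := by
  ext; simp [toForm, toHom_smul]

@[simp]
lemma toForm_zero {n : ℕ} : toForm (0 : ⋀[K]^n M ⊗[K] N) = 0 := by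
  ext; simp [toForm, ← toHomLinear_apply]

lemma toHom_comp_pairingDual {n : ℕ} (t : ⋀[K]^n M ⊗[K] N) :
    toHom t ∘ₗ exteriorPower.pairingDual K M n =
      exteriorPower.alternatingMapLinearEquiv (toForm t) :=
  (exteriorPower.alternatingMapLinearEquiv_comp _ _).symm

/-- On a finite-dimensional space, `Λ^n M ⊗ N` is the space of alternating forms on `M^*`. -/
lemma toForm_bijective [FiniteDimensional K M] (n : ℕ) :
    Function.Bijective (toForm : ⋀[K]^n M ⊗[K] N → (Dual K M) [⋀^Fin n]→ₗ[K] N) := by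
  refine ⟨fun s t h => toHom_bijective.1 ?_, fun B => ?_⟩
  · rw [← LinearMap.cancel_right (pairingDual_bijective n).2, toHom_comp_pairingDual,
      toHom_comp_pairingDual, h]
  · let e := LinearEquiv.ofBijective _ (pairingDual_bijective (K := K) (M := M) n)
    obtain ⟨t, ht⟩ := toHom_bijective.2
      (exteriorPower.alternatingMapLinearEquiv B ∘ₗ e.symm.toLinearMap)
    refine ⟨t, exteriorPower.alternatingMapLinearEquiv.injective ?_⟩
    rw [← toHom_comp_pairingDual, ht]
    ext d
    simp [show exteriorPower.pairingDual K M n = e.toLinearMap from rfl]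

/-- `toForm` as a linear map. -/
noncomputable def toFormLinear (K M N : Type*) [Field K] [AddCommGroup M] [Module K M]
    [AddCommGroup N] [Module K N] (n : ℕ) :
    ⋀[K]^n M ⊗[K] N →ₗ[K] (Dual K M) [⋀^Fin n]→ₗ[K] N where
  toFun := toForm
  map_add' := toForm_add
  map_smul' := toForm_smul

/-- `toForm` as a linear equivalence. -/
noncomputable def toFormEquiv (K M N : Type*) [Field K] [AddCommGroup M] [Module K M]
    [AddCommGroup N] [Module K N] [FiniteDimensional K M] (n : ℕ) :
    ⋀[K]^n M ⊗[K] N ≃ₗ[K] (Dual K M) [⋀^Fin n]→ₗ[K] N :=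
  LinearEquiv.ofBijective (toFormLinear K M N n) (toForm_bijective n)

@[simp]
lemma toForm_toFormEquiv_symm [FiniteDimensional K M] {n : ℕ} (B : (Dual K M) [⋀^Fin n]→ₗ[K] N) :
    toForm ((toFormEquiv K M N n).symm B) = B :=
  (toFormEquiv K M N n).apply_symm_apply B

lemma toForm_map {M' N' : Type*} [AddCommGroup M'] [Module K M'] [AddCommGroup N'] [Module K N']
    {n : ℕ} (f : M →ₗ[K] M') (g : N →ₗ[K] N') (t : ⋀[K]^n M ⊗[K] N) (d : Fin n → Dual K M') :
    toForm (TensorProduct.map (exteriorPower.map n f) g t) d =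
      g (toForm t fun i => d i ∘ₗ f) := by
  rw [toForm_apply, toHom_map, toForm_apply]
  congr 2
  refine exteriorPower.linearMap_ext ?_
  ext v
  simp

/-- The coefficients of `t` lie in a subspace if the values of its form do. -/
lemma mem_range_lTensor_of_toForm_mem [FiniteDimensional K M] {n : ℕ} {W : Submodule K N}
    {t : ⋀[K]^n M ⊗[K] N} (h : ∀ d, toForm t d ∈ W) :
    t ∈ LinearMap.range (W.subtype.lTensor (⋀[K]^n M)) := by
  obtain ⟨u, hu⟩ := (toForm_bijective n).2 ((toForm t).codRestrict W h)
  refine ⟨u, (toForm_bijective n).1 ?_⟩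
  ext d
  have := toForm_map LinearMap.id W.subtype u d
  simp only [exteriorPower.map_id, LinearMap.comp_id, hu] at this
  simpa [LinearMap.lTensor] using this

lemma toForm_mem_of_mem_range_lTensor {n : ℕ} {W : Submodule K N}
    {t : ⋀[K]^n M ⊗[K] N} (h : t ∈ LinearMap.range (W.subtype.lTensor (⋀[K]^n M)))
    (d : Fin n → Dual K M) : toForm t d ∈ W := by
  obtain ⟨u, rfl⟩ := h
  have := toForm_map LinearMap.id W.subtype u d
  simp only [exteriorPower.map_id, LinearMap.comp_id] at this
  rw [LinearMap.lTensor, this]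
  exact Subtype.property _

end ToForm

/-! ### The comultiplication and the Koszul differential in terms of forms -/

section Comultiplication
variable {K : Type*} [Field K] {M : Type*} [AddCommGroup M] [Module K M]

/-- Contracting the first factor of `Δ w ∈ M ⊗ Λ^q M` inserts a linear form as first argument: this
is the Laplace expansion of a determinant. -/
lemma alternatingMapToDual_toHom_comulOne {q : ℕ} (w : ⋀[K]^(q + 1) M) (e : Dual K M)
    (d : Fin q → Dual K M) :
    exteriorPower.alternatingMapToDual K M q d (toHom (comulOne K M q w) e) =
      exteriorPower.alternatingMapToDual K M (q + 1) (Fin.cons e d) w := by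
  suffices h : (exteriorPower.alternatingMapToDual K M q d ∘ₗ
      ((toHomLinear K M (⋀[K]^q M)).flip e) ∘ₗ comulOne K M q) =
      exteriorPower.alternatingMapToDual K M (q + 1) (Fin.cons e d) from LinearMap.congr_fun h w
  refine exteriorPower.linearMap_ext ?_
  ext v
  simp only [LinearMap.compAlternatingMap_apply, LinearMap.comp_apply, comulOne,
    exteriorPower.alternatingMapLinearEquiv_apply_ιMulti,
    AlternatingMap.alternatizeUncurryFin_apply, map_sum]
  rw [exteriorPower.alternatingMapToDual_apply_ιMulti, Matrix.det_succ_column_zero]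
  refine Finset.sum_congr rfl fun i _ => ?_
  rw [map_zsmul, map_zsmul]
  simp only [LinearMap.coe_mk, AddHom.coe_mk, LinearMap.compAlternatingMap_apply,
    TensorProduct.mk_apply, LinearMap.flip_apply, toHomLinear_apply,
    toHom_tmul, map_smul, exteriorPower.alternatingMapToDual_apply_ιMulti]
  simp only [Matrix.of_apply, Fin.cons_zero, smul_eq_mul, zsmul_eq_mul, mul_assoc]
  push_cast
  rfl

lemma compAlternatingMap_domCoprod {ι₁ ι₂ N₁ N₂ P₁ P₂ : Type*} [Fintype ι₁] [Fintype ι₂]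
    [DecidableEq ι₁] [DecidableEq ι₂] [AddCommGroup N₁] [Module K N₁] [AddCommGroup N₂]
    [Module K N₂] [AddCommGroup P₁] [Module K P₁] [AddCommGroup P₂] [Module K P₂]
    (f : N₁ →ₗ[K] P₁) (g : N₂ →ₗ[K] P₂) (a : M [⋀^ι₁]→ₗ[K] N₁) (b : M [⋀^ι₂]→ₗ[K] N₂) :
    (TensorProduct.map f g).compAlternatingMap (a.domCoprod b) =
      (f.compAlternatingMap a).domCoprod (g.compAlternatingMap b) := by
  ext v
  rw [LinearMap.compAlternatingMap_apply, ← AlternatingMap.coe_multilinearMap,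
    ← AlternatingMap.coe_multilinearMap, AlternatingMap.domCoprod_coe,
    AlternatingMap.domCoprod_coe, sum_apply, sum_apply, map_sum]
  refine Finset.sum_congr rfl fun σ _ => ?_
  induction σ using Quotient.inductionOn' with | _ σ
  rw [AlternatingMap.domCoprod.summand_mk'', AlternatingMap.domCoprod.summand_mk'', smul_apply,
    smul_apply, Units.smul_def, Units.smul_def, map_zsmul]
  rfl

/-- The alternating form given by a product of linear forms is the alternatization of their
pointwise product. -/
lemma alternatization_mkPiAlgebra {n : ℕ} (d : Fin n → Dual K M) :
    MultilinearMap.alternatization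
        ((MultilinearMap.mkPiAlgebra K (Fin n) K).compLinearMap d) =
      (exteriorPower.alternatingMapToDual K M n d).compAlternatingMap
        (exteriorPower.ιMulti K n) := by
  ext v
  simp [MultilinearMap.alternatization_apply, Matrix.det_apply]

/-- Contracting both factors of `Δ w ∈ Λ^p M ⊗ Λ^q M` by products of linear forms is the same as
contracting `w` by the product of all of these forms. -/
lemma alternatingMapToDual_toForm_comul {p q : ℕ} (w : ⋀[K]^(p + q) M) (d : Fin p → Dual K M)
    (e : Fin q → Dual K M) :
    exteriorPower.alternatingMapToDual K M q e (toForm (comul K M p q w) d) =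
      exteriorPower.alternatingMapToDual K M (p + q) (Fin.append d e) w := by
  have hG (t : ⋀[K]^p M ⊗[K] ⋀[K]^q M) : exteriorPower.alternatingMapToDual K M q e (toForm t d) =
      LinearMap.mul' K K (TensorProduct.map (exteriorPower.alternatingMapToDual K M p d)
        (exteriorPower.alternatingMapToDual K M q e) t) := by
    induction t with
    | zero => simp
    | add s t hs ht => simp [toForm_add, hs, ht]
    | tmul u y => simp
  rw [hG]
  suffices h : LinearMap.mul' K K ∘ₗ TensorProduct.map (exteriorPower.alternatingMapToDual K M p d)
        (exteriorPower.alternatingMapToDual K M q e) ∘ₗ comul K M p q =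
      exteriorPower.alternatingMapToDual K M (p + q) (Fin.append d e) from LinearMap.congr_fun h w
  refine exteriorPower.linearMap_ext ?_
  ext v
  simp only [LinearMap.compAlternatingMap_apply, LinearMap.comp_apply, comul,
    exteriorPower.alternatingMapLinearEquiv_apply_ιMulti, AlternatingMap.domDomCongr_apply]
  rw [← LinearMap.compAlternatingMap_apply, compAlternatingMap_domCoprod,
    ← alternatization_mkPiAlgebra, ← alternatization_mkPiAlgebra,
    ← MultilinearMap.domCoprod_alternization, exteriorPower.alternatingMapToDual_apply_ιMulti,
    MultilinearMap.alternatization_apply, map_sum,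
    ← Matrix.det_submatrix_equiv_self finSumFinEquiv, Matrix.det_apply]
  refine Finset.sum_congr rfl fun σ _ => ?_
  rw [Units.smul_def, Units.smul_def, map_zsmul]
  simp [MultilinearMap.domCoprod_apply, Fintype.prod_sum_type]

lemma toForm_toHom_assoc_comulOne {N : Type*} [AddCommGroup N] [Module K N] {q : ℕ}
    (t : ⋀[K]^(q + 1) M ⊗[K] N) (e : Dual K M) (d : Fin q → Dual K M) :
    toForm (toHom (TensorProduct.assoc K M (⋀[K]^q M) N ((comulOne K M q).rTensor N t)) e) d =
      toForm t (Fin.cons e d) := by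
  induction t with
  | zero => simp [← toHomLinear_apply]
  | add s t hs ht => simp [toForm_add, toHom_add, hs, ht]
  | tmul w y =>
    rw [toForm_tmul, ← alternatingMapToDual_toHom_comulOne, LinearMap.rTensor_tmul]
    generalize comulOne K M q w = z
    induction z with
    | zero => simp [← toHomLinear_apply]
    | add s t hs ht => simp [TensorProduct.add_tmul, toForm_add, toHom_add, hs, ht, add_smul]
    | tmul v u => simp [toForm_smul, mul_smul]

end Comultiplication

section Koszul
variable {K : Type*} [Field K] {V : Type*} [AddCommGroup V] [Module K V]

/-- The Koszul differential in terms of alternating forms. -/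
lemma toForm_koszulD {ι : Type*} [Fintype ι] (b : Basis ι K V) {p : ℕ}
    (t : ⋀[K]^(p + 1) V ⊗[K] SymmetricAlgebra K V) (d : Fin p → Dual K V) :
    toForm (koszulD K V p t) d =
      ∑ i, SymmetricAlgebra.ι K V (b i) * toForm t (Fin.cons (b.coord i) d) := by
  induction t with
  | zero => simp
  | add s t hs ht => simp [toForm_add, hs, ht, mul_add, Finset.sum_add_distrib]
  | tmul w f =>
    simp only [toForm_tmul, ← alternatingMapToDual_toHom_comulOne]
    simp only [koszulD, LinearMap.comp_apply, LinearMap.rTensor_tmul]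
    generalize comulOne K V p w = z
    induction z with
    | zero => simp [← toHomLinear_apply]
    | add s t hs ht =>
      simp only [TensorProduct.add_tmul, map_add, toForm_add, AlternatingMap.add_apply, hs, ht,
        toHom_add, LinearMap.add_apply, add_smul, mul_add, Finset.sum_add_distrib]
    | tmul v u =>
      simp only [LinearEquiv.coe_coe, TensorProduct.assoc_tmul, TensorProduct.leftComm_tmul,
        LinearMap.lTensor_tmul, TensorProduct.lift.tmul, LinearMap.comp_apply, toForm_tmul,
        LinearMap.mul_apply', toHom_tmul, map_smul, smul_eq_mul, mul_smul]
      conv_lhs => rw [← b.sum_repr v]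
      simp only [map_sum, map_smul, Finset.sum_mul, Finset.smul_sum, Basis.coord_apply]
      refine Finset.sum_congr rfl fun i _ => ?_
      simp only [mul_smul_comm, smul_mul_assoc]
      rw [smul_comm]

end Koszul

/-! ### Forms of low degree and minimal resolutions -/

section Forms
variable {K : Type*} [Field K] {V : Type*} [AddCommGroup V] [Module K V]

lemma symmetricAlgebra_ι_injective : Function.Injective (SymmetricAlgebra.ι K V) := by
  refine (injective_iff_map_eq_zero _).2 fun v hv => ?_
  refine (Module.forall_dual_apply_eq_zero_iff K v).1 fun d => ?_
  rw [← SymmetricAlgebra.lift_ι_apply d v, hv, map_zero]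

lemma mem_forms_one {x : SymmetricAlgebra K V} :
    x ∈ forms K V 1 ↔ ∃ v, SymmetricAlgebra.ι K V v = x := by
  simp [forms]

lemma ι_mul_ι_mem_forms (v w : V) :
    SymmetricAlgebra.ι K V v * SymmetricAlgebra.ι K V w ∈ forms K V 2 := by
  rw [forms, pow_two]
  exact Submodule.mul_mem_mul ⟨v, rfl⟩ ⟨w, rfl⟩

lemma ι_linearForm {x : SymmetricAlgebra K V} (hx : x ∈ forms K V 1) :
    SymmetricAlgebra.ι K V (linearForm x) = x :=
  Function.invFun_eq (mem_forms_one.1 hx)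

lemma algebraMapInv_eq_zero_of_mem_forms {n : ℕ} (hn : n ≠ 0) {x : SymmetricAlgebra K V}
    (hx : x ∈ forms K V n) : SymmetricAlgebra.algebraMapInv x = 0 := by
  obtain ⟨n, rfl⟩ := Nat.exists_eq_succ_of_ne_zero hn
  rw [forms, Nat.succ_eq_add_one, pow_succ] at hx
  induction hx using Submodule.mul_induction_on' with
  | mem_mul_mem a _ b hb =>
    obtain ⟨v, rfl⟩ := hb
    rw [map_mul, SymmetricAlgebra.algebraMapInv_ι, mul_zero]
  | add a _ b _ ha hb => rw [map_add, ha, hb, add_zero]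

/-- An ideal that is generated by quadrics contains no form of degree less than two. -/
lemma two_le_of_mem_forms_of_mem {I : Ideal (SymmetricAlgebra K V)} (hI : GeneratedByQuadrics I)
    {n : ℕ} {x : SymmetricAlgebra K V} (hx : x ∈ forms K V n) (hxI : x ∈ I) (hx0 : x ≠ 0) :
    2 ≤ n := by
  -- A homomorphism to the dual numbers that sends linear forms to multiples of `ε` kills `I`.
  have key (d : Dual K V) : SymmetricAlgebra.lift (LinearMap.toSpanSingleton K (DualNumber K)
      DualNumber.eps ∘ₗ d) x = 0 := by
    rw [← hI] at hxI
    refine (Ideal.span_le (I := RingHom.ker (SymmetricAlgebra.lift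
      (LinearMap.toSpanSingleton K (DualNumber K) DualNumber.eps ∘ₗ d)))).2 ?_ hxI
    rintro Q ⟨-, hQ⟩
    rw [SetLike.mem_coe, forms, pow_two] at hQ
    rw [SetLike.mem_coe, RingHom.mem_ker]
    induction hQ using Submodule.mul_induction_on' with
    | mem_mul_mem a ha b hb =>
      obtain ⟨v, rfl⟩ := ha
      obtain ⟨w, rfl⟩ := hb
      simp
    | add a _ b _ ha hb => rw [map_add, ha, hb, add_zero]
  by_contra! h
  interval_cases n
  · obtain ⟨c, rfl⟩ := Submodule.mem_one.1 (by simpa [forms] using hx)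
    have h0 : c = 0 := by
      simpa [TrivSqZeroExt.algebraMap_eq_inl'] using congr_arg TrivSqZeroExt.fst (key 0)
    exact hx0 (by rw [h0, map_zero])
  · obtain ⟨v, rfl⟩ := mem_forms_one.1 hx
    refine hx0 ?_
    suffices v = 0 by simp [this]
    refine (Module.forall_dual_apply_eq_zero_iff K v).1 fun d => ?_
    simpa using congr_arg TrivSqZeroExt.snd (key d)

end Forms

namespace MinimalResolution

variable {K : Type*} [Field K] {V : Type*} [AddCommGroup V] [Module K V]
  {I : Ideal (SymmetricAlgebra K V)} (F : MinimalResolution I)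

lemma algebraMapInv_d (i : ℕ) (b : Fin (F.rank (i + 1))) (c : Fin (F.rank i)) :
    SymmetricAlgebra.algebraMapInv (F.d i b c) = 0 := by
  by_cases h : F.d i b c = 0
  · rw [h, map_zero]
  · exact algebraMapInv_eq_zero_of_mem_forms (Nat.sub_pos_of_lt (F.minimal i b c h)).ne'
      (F.d_mem i b c)

/-- By minimality, no combination of rows of a differential is a nonzero constant vector. -/
lemma eq_zero_of_eq_vecMul (i : ℕ) {x : Fin (F.rank i) → K}
    {y : Fin (F.rank (i + 1)) → SymmetricAlgebra K V}
    (h : (fun c => algebraMap K (SymmetricAlgebra K V) (x c)) = Matrix.vecMul y (F.d i)) :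
    x = 0 := by
  ext c
  have := congr_arg SymmetricAlgebra.algebraMapInv (congr_fun h c)
  simpa [SymmetricAlgebra.algebraMap_leftInverse V (x c), Matrix.vecMul, dotProduct,
    F.algebraMapInv_d] using this

lemma eq_zero_of_sum_smul_gen {x : Fin (F.rank 0) → K} (h : ∑ c, x c • F.gen c = 0) : x = 0 := by
  obtain ⟨y, hy⟩ := (F.exact_zero fun c => algebraMap K _ (x c)).1
    (by simpa [Algebra.smul_def] using h)
  exact F.eq_zero_of_eq_vecMul 0 hy

lemma eq_zero_of_sum_smul_d (i : ℕ) {x : Fin (F.rank (i + 1)) → K}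
    (h : ∀ c, ∑ b, x b • F.d i b c = 0) : x = 0 := by
  obtain ⟨y, hy⟩ := (F.exact_succ i fun b => algebraMap K _ (x b)).1
    (by ext c; simpa [Algebra.smul_def, Matrix.vecMul, dotProduct] using h c)
  exact F.eq_zero_of_eq_vecMul (i + 1) hy

lemma gen_mem_ideal (c : Fin (F.rank 0)) : F.gen c ∈ I :=
  F.span_gen.le (Ideal.subset_span ⟨c, rfl⟩)

variable (hI : GeneratedByQuadrics I)
include hI

/-- The `p`-th term of the resolution has no generators of degree less than `p + 2`. -/
lemma add_two_le_deg (p : ℕ) (c : Fin (F.rank p)) : p + 2 ≤ F.deg p c := by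
  induction p with
  | zero =>
    refine (zero_add 2).le.trans
      (two_le_of_mem_forms_of_mem hI (F.gen_mem c) (F.gen_mem_ideal c) fun h => ?_)
    have := F.eq_zero_of_sum_smul_gen (x := Pi.single c 1) (by simp [Pi.single_apply, h])
    simpa using congr_fun this c
  | succ p ih =>
    obtain ⟨a, ha⟩ : ∃ a, F.d p c a ≠ 0 := by
      by_contra! h
      have := F.eq_zero_of_sum_smul_d p (x := Pi.single c 1) (by simp [Pi.single_apply, h])
      simpa using congr_fun this c
    have := F.minimal p c a ha
    have := ih a
    omega

lemma d_eq_zero_of_deg_ne {p : ℕ} (b : F.StrandIndex (p + 1)) {c : Fin (F.rank p)}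
    (hc : F.deg p c ≠ p + 2) : F.d p b c = 0 := by
  by_contra h
  have := F.minimal p b c h
  have := F.add_two_le_deg hI p c
  have := b.2
  omega

omit hI in
lemma sum_strandIndex {N : Type*} [AddCommMonoid N] {p : ℕ} {f : Fin (F.rank p) → N}
    (hf : ∀ c, F.deg p c ≠ p + 2 → f c = 0) : ∑ c : F.StrandIndex p, f c = ∑ c, f c := by
  rw [← Fintype.sum_subtype_add_sum_subtype (fun c => F.deg p c = p + 2) f,
    Finset.sum_eq_zero (s := (Finset.univ : Finset {c // ¬F.deg p c = p + 2})), add_zero]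
  exact fun c _ => hf c c.2

omit hI in
lemma ι_linearForm_d {p : ℕ} (b : F.StrandIndex (p + 1)) (c : F.StrandIndex p) :
    SymmetricAlgebra.ι K V (linearForm (F.d p b c)) = F.d p b c := by
  refine ι_linearForm ?_
  have := F.d_mem p b c
  rwa [b.2, c.2, show p + 1 + 2 - (p + 2) = 1 by omega] at this

omit hI in
/-- The contraction `V_{p+1} → V_p ⊗ V → V_p` of the strand map by a linear form on `V`. -/
noncomputable def contract (p : ℕ) (d : Dual K V) : F.Strand (p + 1) →ₗ[K] F.Strand p :=
  (TensorProduct.rid K (F.Strand p)).toLinearMap ∘ₗ d.lTensor (F.Strand p) ∘ₗ F.strandMap p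

omit hI in
lemma contract_apply (p : ℕ) (d : Dual K V) (s : F.Strand (p + 1)) (c : F.StrandIndex p) :
    F.contract p d s c = ∑ b, s b * d (linearForm (F.d p b.1 c.1)) := by
  simp only [contract, strandMap, LinearMap.comp_apply, LinearMap.sum_apply, map_sum,
    LinearMap.smulRight_apply, map_smul, LinearMap.lTensor_tmul, LinearEquiv.coe_coe,
    TensorProduct.rid_tmul, LinearMap.proj_apply, Finset.sum_apply, Pi.smul_apply, smul_eq_mul,
    Pi.single_apply]
  simp

omit hI in
lemma contract_add (p : ℕ) (d e : Dual K V) (s : F.Strand (p + 1)) :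
    F.contract p (d + e) s = F.contract p d s + F.contract p e s := by
  ext c
  simp [contract_apply, mul_add, Finset.sum_add_distrib]

omit hI in
lemma contract_smul (p : ℕ) (a : K) (d : Dual K V) (s : F.Strand (p + 1)) :
    F.contract p (a • d) s = a • F.contract p d s := by
  ext c
  simp [contract_apply, Finset.mul_sum, mul_left_comm]

omit hI in
lemma toHom_comm_rTensor_strandMap {N : Type*} [AddCommGroup N] [Module K N] (p : ℕ)
    (θ : F.Strand p →ₗ[K] N) (s : F.Strand (p + 1)) (d : Dual K V) :
    toHom (TensorProduct.comm K _ V (θ.rTensor V (F.strandMap p s))) d = θ (F.contract p d s) := by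
  rw [contract, LinearMap.comp_apply, LinearMap.comp_apply]
  generalize F.strandMap p s = t
  induction t with
  | zero => simp [← toHomLinear_apply]
  | add s t hs ht => simp [toHom_add, hs, ht]
  | tmul v n => simp

omit hI in
lemma apply_toHom_strandMap (p : ℕ) (s : F.Strand (p + 1)) (d : Dual K V)
    (l : Dual K (F.Strand p)) : d (toHom (F.strandMap p s) l) = l (F.contract p d s) := by
  rw [contract, LinearMap.comp_apply, LinearMap.comp_apply]
  generalize F.strandMap p s = t
  induction t with
  | zero => simp [← toHomLinear_apply]
  | add s t hs ht => simp [toHom_add, hs, ht]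
  | tmul v n => simp [mul_comm]

/-- The strand map is a differential: this is the quadratic part of `d² = 0`. -/
lemma contract_contract_self (p : ℕ) (d : Dual K V) (s : F.Strand (p + 2)) :
    F.contract p d (F.contract (p + 1) d s) = 0 := by
  have h (b : F.StrandIndex (p + 2)) (a : F.StrandIndex p) :
      ∑ c : F.StrandIndex (p + 1), d (linearForm (F.d (p + 1) b c)) * d (linearForm (F.d p c a)) =
        0 := by
    have h1 : ∑ c, F.d (p + 1) b c * F.d p c a = 0 := by
      have := (F.exact_succ p (F.d (p + 1) b)).2 ⟨Pi.single b.1 1, by ext; simp⟩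
      simpa [Matrix.vecMul, dotProduct] using congr_fun this a
    rw [← F.sum_strandIndex fun c hc => by rw [F.d_eq_zero_of_deg_ne hI b hc, zero_mul]] at h1
    have h2 := congr_arg (SymmetricAlgebra.lift d) h1
    rw [map_sum, map_zero] at h2
    rw [← h2]
    refine Finset.sum_congr rfl fun c _ => ?_
    rw [← SymmetricAlgebra.lift_ι_apply d, ← SymmetricAlgebra.lift_ι_apply d, F.ι_linearForm_d,
      F.ι_linearForm_d c a, map_mul]
  ext a
  simp only [contract_apply, Finset.sum_mul, Pi.zero_apply]
  rw [Finset.sum_comm]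
  simp_rw [mul_assoc, ← Finset.mul_sum, h, mul_zero, Finset.sum_const_zero]

lemma contract_contract_swap (p : ℕ) (d e : Dual K V) (s : F.Strand (p + 2)) :
    F.contract p d (F.contract (p + 1) e s) = -F.contract p e (F.contract (p + 1) d s) := by
  have := F.contract_contract_self hI p (d + e) s
  rw [contract_add, contract_add, map_add, map_add, F.contract_contract_self hI,
    F.contract_contract_self hI, zero_add, add_zero, add_comm] at this
  exact eq_neg_of_add_eq_zero_right this

/-- By minimality, a linear syzygy whose linear forms all vanish is zero. -/
lemma eq_zero_of_contract_eq_zero (p : ℕ) {s : F.Strand (p + 1)}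
    (h : ∀ d, F.contract p d s = 0) : s = 0 := by
  have h1 (c : F.StrandIndex p) : ∑ b, s b • linearForm (F.d p b.1 c.1) = 0 := by
    refine (Module.forall_dual_apply_eq_zero_iff K _).1 fun d => ?_
    simpa [contract_apply] using congr_fun (h d) c
  let x : Fin (F.rank (p + 1)) → K := fun b => if hb : F.deg (p + 1) b = p + 1 + 2 then s ⟨b, hb⟩
    else 0
  have hx (b : F.StrandIndex (p + 1)) : x b = s b := by simp [x, b.2]
  have hx0 : x = 0 := by
    refine F.eq_zero_of_sum_smul_d p fun c => ?_
    rw [← F.sum_strandIndex fun b hb => by simp [x, hb]]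
    by_cases hc : F.deg p c = p + 2
    · simpa [hx, F.ι_linearForm_d _ ⟨c, hc⟩] using
        congr_arg (SymmetricAlgebra.ι K V) (h1 ⟨c, hc⟩)
    · simp [F.d_eq_zero_of_deg_ne hI _ hc]
  ext b
  rw [← hx, hx0, Pi.zero_apply, Pi.zero_apply]

end MinimalResolution

/-! ### Comparison of the linear strand with the Koszul complex -/

/-- A family of alternating `n`-forms depending linearly on a vector `d` is an alternating
`(n + 1)`-form if it vanishes whenever `d` is among the other arguments. -/
lemma exists_alternatingMap_cons {K M N : Type*} [Field K] [AddCommGroup M] [Module K M]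
    [AddCommGroup N] [Module K N] {n : ℕ} (f : M →ₗ[K] M [⋀^Fin n]→ₗ[K] N)
    (hf : ∀ d v i, v i = d → f d v = 0) :
    ∃ g : M [⋀^Fin (n + 1)]→ₗ[K] N, ∀ d v, g (Fin.cons d v) = f d v := by
  refine ⟨{ LinearMap.uncurryLeft (AlternatingMap.toMultilinearMapLM (S := K) ∘ₗ f) with
    map_eq_zero_of_eq' := fun v i j hv hij => ?_ }, fun d v => ?_⟩
  · change f (v 0) (Fin.tail v) = 0
    induction i using Fin.cases with
    | zero =>
      induction j using Fin.cases with
      | zero => exact absurd rfl hij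
      | succ j => exact hf _ _ j hv.symm
    | succ i =>
      induction j using Fin.cases with
      | zero => exact hf _ _ i hv
      | succ j =>
        exact (f (v 0)).map_eq_zero_of_eq _ hv (fun h => hij (congr_arg Fin.succ h))
  · change f ((Fin.cons d v : Fin (n + 1) → M) 0) (Fin.tail (Fin.cons d v : Fin (n + 1) → M)) =
      f d v
    rw [Fin.cons_zero, Fin.tail_cons]

/-- An alternating map vanishes at a vector if it vanishes after moving one of its entries to the
first place. -/
lemma alternatingMap_eq_zero_of_cons {K M N : Type*} [Field K] [AddCommGroup M] [Module K M]
    [AddCommGroup N] [Module K N] {n : ℕ} (g : M [⋀^Fin (n + 1)]→ₗ[K] N) {d : M}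
    (hg : ∀ w, g (Fin.cons d w) = 0) {v : Fin (n + 1) → M} {i : Fin (n + 1)} (hi : v i = d) :
    g v = 0 := by
  have h := g.map_perm v (Equiv.swap 0 i)
  have h0 : g (v ∘ Equiv.swap 0 i) = 0 := by
    rw [← Fin.cons_self_tail (v ∘ Equiv.swap 0 i)]
    simpa [hi] using hg (Fin.tail (v ∘ Equiv.swap 0 i))
  rw [h0] at h
  exact ((smul_eq_zero_iff_eq _).1 h.symm)

namespace MinimalResolution

variable {K : Type*} [Field K] {V : Type*} [AddCommGroup V] [Module K V]
  [FiniteDimensional K V] {I : Ideal (SymmetricAlgebra K V)} (F : MinimalResolution I)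

/-- The properties of the comparison map `θ_p : V_p → Λ^p V ⊗ S` between the linear strand and the
Koszul complex. Besides those of `θ_p` itself, these are the two compatibilities with the strand
map `V_{p+1} → V_p ⊗ V` that make the construction of `θ_{p+1}` possible. -/
structure IsComparison (p : ℕ) (θ : F.Strand p →ₗ[K] ⋀[K]^p V ⊗[K] SymmetricAlgebra K V) :
    Prop where
  corresponds : ∀ t, F.Corresponds p t (θ t)
  injective : Function.Injective θ
  mem_quadrics : ∀ t d, toForm (θ t) d ∈ quadrics I
  mem_koszulSyzygies : ∀ t, θ t ∈ koszulSyzygies I p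
  contract_eq_zero : ∀ (s : F.Strand (p + 1)) (d : Dual K V) (v : Fin p → Dual K V) (i : Fin p),
    v i = d → toForm (θ (F.contract p d s)) v = 0
  sum_eq_zero : ∀ (s : F.Strand (p + 1)) (v : Fin p → Dual K V),
    ∑ i, SymmetricAlgebra.ι K V (finBasis K V i) *
      toForm (θ (F.contract p ((finBasis K V).coord i) s)) v = 0

omit [FiniteDimensional K V] in
lemma gen_mem_quadrics (c : F.StrandIndex 0) : F.gen c ∈ quadrics I := by
  refine ⟨F.gen_mem_ideal c, ?_⟩
  have := F.gen_mem c
  rwa [c.2] at this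

variable (hI : GeneratedByQuadrics I)
include hI

lemma exists_isComparison_zero : ∃ θ, F.IsComparison 0 θ := by
  let θ₀ : F.Strand 0 →ₗ[K] SymmetricAlgebra K V :=
    Fintype.linearCombination K fun c : F.StrandIndex 0 => F.gen c.1
  let θ := TensorProduct.mk K (⋀[K]^0 V) (SymmetricAlgebra K V)
    ((exteriorPower.zeroEquiv K V).symm 1) ∘ₗ θ₀
  have hθ (s) (d) : toForm (θ s) d = ∑ c : F.StrandIndex 0, s c • F.gen c.1 := by
    have h1 : (exteriorPower.zeroEquiv K V).symm 1 = exteriorPower.ιMulti K 0 ![] := by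
      rw [LinearEquiv.symm_apply_eq, exteriorPower.zeroEquiv_ιMulti]
    change toForm (_ ⊗ₜ[K] θ₀ s) d = _
    rw [toForm_tmul, h1]
    simp [θ₀, Fintype.linearCombination_apply]
  have hmem (t) (d) : toForm (θ t) d ∈ quadrics I := by
    rw [hθ]
    exact Submodule.sum_mem _ fun c _ => Submodule.smul_mem _ _ (F.gen_mem_quadrics c)
  refine ⟨θ, ⟨fun t => ?_, ?_, hmem, fun t => mem_range_lTensor_of_toForm_mem (hmem t),
    fun s d v i => i.elim0, fun s v => ?_⟩⟩
  · rfl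
  · refine (injective_iff_map_eq_zero _).2 fun s hs => ?_
    have h := hθ s 0
    rw [hs, toForm_zero, AlternatingMap.zero_apply] at h
    let x : Fin (F.rank 0) → K := fun c => if hc : F.deg 0 c = 0 + 2 then s ⟨c, hc⟩ else 0
    have hx (c : F.StrandIndex 0) : x c = s c := by simp [x, c.2]
    have hx0 : x = 0 := by
      refine F.eq_zero_of_sum_smul_gen ?_
      rw [← F.sum_strandIndex fun c hc => by simp [x, hc], h]
      simp_rw [hx]
    ext c
    rw [← hx, hx0, Pi.zero_apply, Pi.zero_apply]
  · -- this is the relation `d₀ · gen = 0`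
    have h (b : F.StrandIndex 1) :
        ∑ c : F.StrandIndex 0, F.d 0 b c * F.gen c = 0 := by
      rw [F.sum_strandIndex (f := fun c => F.d 0 b c * F.gen c) fun c hc => by
        rw [F.d_eq_zero_of_deg_ne hI b hc, zero_mul]]
      exact (F.exact_zero (F.d 0 b)).2 ⟨Pi.single b.1 1, by ext; simp⟩
    have hl (b : F.StrandIndex 1) (c : F.StrandIndex 0) :
        ∑ i, (finBasis K V).coord i (linearForm (F.d 0 b.1 c.1)) •
          SymmetricAlgebra.ι K V (finBasis K V i) = F.d 0 b c := by
      simp_rw [← map_smul, ← map_sum, Basis.coord_apply, (finBasis K V).sum_repr]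
      exact F.ι_linearForm_d b c
    calc _ = ∑ b : F.StrandIndex 1, s b • ∑ c : F.StrandIndex 0,
          (∑ i, (finBasis K V).coord i (linearForm (F.d 0 b.1 c.1)) •
            SymmetricAlgebra.ι K V (finBasis K V i)) * F.gen c := by
          simp only [hθ, contract_apply, Finset.mul_sum, Finset.sum_smul, Finset.smul_sum,
            Finset.sum_mul]
          rw [Finset.sum_comm]
          rw [Finset.sum_congr rfl fun c _ => Finset.sum_comm]
          rw [Finset.sum_comm]
          refine Finset.sum_congr rfl fun b _ => Finset.sum_congr rfl fun c _ =>
            Finset.sum_congr rfl fun i _ => ?_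
          rw [mul_smul_comm, smul_mul_assoc, smul_smul]
      _ = 0 := by simp only [hl, h, smul_zero, Finset.sum_const_zero]

/-- The form `θ_{p+1}(s)` is given by `(d, v) ↦ θ_p(φ̃(s)(d))(v)`. -/
lemma IsComparison.exists_succ {p : ℕ}
    {θ : F.Strand p →ₗ[K] ⋀[K]^p V ⊗[K] SymmetricAlgebra K V} (hθ : F.IsComparison p θ) :
    ∃ θ', F.IsComparison (p + 1) θ' ∧ ∀ s d v,
      toForm (θ' s) (Fin.cons d v) = toForm (θ (F.contract p d s)) v := by
  have hex (s : F.Strand (p + 1)) : ∃ σ : ⋀[K]^(p + 1) V ⊗[K] SymmetricAlgebra K V,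
      ∀ d v, toForm σ (Fin.cons d v) = toForm (θ (F.contract p d s)) v := by
    obtain ⟨g, hg⟩ := exists_alternatingMap_cons
      { toFun := fun d => toForm (θ (F.contract p d s))
        map_add' := fun d e => by rw [contract_add, map_add, toForm_add]
        map_smul' := fun c d => by rw [contract_smul, map_smul, toForm_smul, RingHom.id_apply] }
      (hθ.contract_eq_zero s)
    exact ⟨(toFormEquiv K V _ (p + 1)).symm g, fun d v => by
      rw [toForm_toFormEquiv_symm]
      exact hg d v⟩
  have hext {σ τ : ⋀[K]^(p + 1) V ⊗[K] SymmetricAlgebra K V}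
      (h : ∀ d v, toForm σ (Fin.cons d v) = toForm τ (Fin.cons d v)) : σ = τ := by
    refine (toForm_bijective _).1 ?_
    ext v
    rw [← Fin.cons_self_tail v]
    exact h _ _
  choose f hf using hex
  let θ' : F.Strand (p + 1) →ₗ[K] ⋀[K]^(p + 1) V ⊗[K] SymmetricAlgebra K V :=
    { toFun := f
      map_add' := fun s t => hext fun d v => by
        simp only [hf, map_add, toForm_add, AlternatingMap.add_apply]
      map_smul' := fun c s => hext fun d v => by
        simp only [hf, map_smul, toForm_smul, AlternatingMap.smul_apply, RingHom.id_apply] }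
  have hθ' (s d v) : toForm (θ' s) (Fin.cons d v) = toForm (θ (F.contract p d s)) v := hf s d v
  have hmem (t d) : toForm (θ' t) d ∈ quadrics I := by
    rw [← Fin.cons_self_tail d, hθ']
    exact hθ.mem_quadrics _ _
  refine ⟨θ', ⟨fun t => ⟨θ, hθ.corresponds, ?_⟩, ?_, hmem,
    fun t => ⟨mem_range_lTensor_of_toForm_mem (hmem t), ?_⟩, fun s d v i hi => ?_,
    fun s v => ?_⟩, hθ'⟩
  · refine (toHom_bijective (K := K) (M := V)
      (N := ⋀[K]^p V ⊗[K] SymmetricAlgebra K V)).1 ?_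
    ext d : 1
    refine (toForm_bijective p).1 ?_
    ext v
    rw [toForm_toHom_assoc_comulOne, hθ', toHom_comm_rTensor_strandMap]
  · refine (injective_iff_map_eq_zero _).2 fun s hs =>
      F.eq_zero_of_contract_eq_zero hI p fun d => hθ.injective ?_
    rw [map_zero]
    refine (toForm_bijective _).1 ?_
    ext v
    rw [← hθ', hs, toForm_zero, toForm_zero, AlternatingMap.zero_apply, AlternatingMap.zero_apply]
  · rw [SetLike.mem_coe, LinearMap.mem_ker]
    refine (toForm_bijective _).1 ?_
    ext v
    rw [toForm_koszulD (finBasis K V)]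
    simpa [hθ'] using hθ.sum_eq_zero t v
  · refine alternatingMap_eq_zero_of_cons _ (fun w => ?_) hi
    rw [hθ', F.contract_contract_self hI, map_zero, toForm_zero, AlternatingMap.zero_apply]
  · rw [← Fin.cons_self_tail v]
    simp only [hθ', F.contract_contract_swap hI p (v 0), map_neg]
    have := hθ.sum_eq_zero (F.contract (p + 1) (v 0) s) (Fin.tail v)
    rw [← neg_eq_zero, ← Finset.sum_neg_distrib] at this
    rw [← this]
    refine Finset.sum_congr rfl fun i _ => ?_
    rw [← neg_one_smul K (θ _), toForm_smul, AlternatingMap.smul_apply, neg_one_smul, mul_neg]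

lemma exists_isComparison (p : ℕ) : ∃ θ, F.IsComparison p θ := by
  induction p with
  | zero => exact F.exists_isComparison_zero hI
  | succ p ih =>
    obtain ⟨θ, hθ⟩ := ih
    obtain ⟨θ', hθ', -⟩ := hθ.exists_succ F hI
    exact ⟨θ', hθ'⟩

/-- The Koszul syzygy of a linear syzygy `s` is nonzero if `s` is, and it involves only the linear
forms in `L_s`. -/
lemma exists_corresponds {p : ℕ} {s : F.Strand (p + 1)} (hs : s ≠ 0) :
    ∃ σ ∈ koszulSyzygies I (p + 1), F.Corresponds (p + 1) s σ ∧ σ ≠ 0 ∧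
      ∀ d : Dual K V, (∀ v ∈ F.involvedForms (p + 1) s, d v = 0) →
        ∀ v, toForm σ (Fin.cons d v) = 0 := by
  obtain ⟨θ, hθ⟩ := F.exists_isComparison hI p
  obtain ⟨θ', hθ', h⟩ := hθ.exists_succ F hI
  refine ⟨θ' s, hθ'.mem_koszulSyzygies s, hθ'.corresponds s, ?_, fun d hd v => ?_⟩
  · rwa [Ne, map_eq_zero_iff _ hθ'.injective]
  · have h0 : F.contract p d s = 0 := by
      refine (Module.forall_dual_apply_eq_zero_iff K _).1 fun l => ?_
      rw [← apply_toHom_strandMap]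
      exact hd _ ⟨l, rfl⟩
    rw [h, h0, map_zero, toForm_zero, AlternatingMap.zero_apply]

end MinimalResolution

/-! ### Exactness of the Koszul complex -/

section Wedge
variable {K : Type*} [Field K] {M A : Type*} [AddCommGroup M] [Module K M] [CommRing A]
  [Algebra K A]

lemma wedge_apply {q : ℕ} (l : M →ₗ[K] A) (a : M [⋀^Fin q]→ₗ[K] A) (v : Fin (q + 1) → M) :
    wedge l a v = ∑ i : Fin (q + 1), (-1) ^ (i : ℕ) • (l (v i) * a (i.removeNth v)) := by
  simp [wedge, AlternatingMap.alternatizeUncurryFin_apply]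

/-- The Leibniz rule for the contraction of `l ∧ a` by `d`. -/
lemma wedge_cons {q : ℕ} (l : M →ₗ[K] A) (a : M [⋀^Fin (q + 1)]→ₗ[K] A) (d : M)
    (v : Fin (q + 1) → M) :
    wedge l a (Fin.cons d v) = l d * a v - wedge l (a.curryLeft d) v := by
  rw [wedge_apply, Fin.sum_univ_succ, wedge_apply, sub_eq_add_neg, ← Finset.sum_neg_distrib]
  congr 1
  · simp
  · refine Finset.sum_congr rfl fun i _ => ?_
    rw [Fin.cons_succ, Fin.val_succ, pow_succ, mul_neg_one, neg_smul]
    have h : i.succ.removeNth (Fin.cons d v : Fin (q + 2) → M) =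
        Matrix.vecCons d (i.removeNth v) := by
      funext j
      induction j using Fin.cases with
      | zero => simp [Fin.removeNth]
      | succ j => simp [Fin.removeNth]
    rw [h, AlternatingMap.curryLeft_apply_apply]

/-- The Leibniz rule if the contraction of `a` by `d` is zero. -/
lemma wedge_cons_of_eq_zero {q : ℕ} (l : M →ₗ[K] A) {a : M [⋀^Fin q]→ₗ[K] A} {d : M}
    (h : ∀ w, (∃ i, w i = d) → a w = 0) (v : Fin q → M) :
    wedge l a (Fin.cons d v) = l d * a v := by
  cases q with
  | zero => simp [wedge_apply]
  | succ q =>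
    have h0 : a.curryLeft d = 0 := by
      ext w
      exact h _ ⟨0, by simp⟩
    rw [wedge_cons, h0, sub_eq_self, wedge_apply]
    simp

end Wedge

/-- The quadratic form of an alternating bilinear form vanishes. -/
lemma sum_mul_mul_eq_zero {ι S : Type*} [Fintype ι] [CommRing S] (x : ι → S) (B : ι → ι → S)
    (h0 : ∀ i, B i i = 0) (h : ∀ i j, B i j = -B j i) :
    ∑ i, x i * ∑ j, x j * B i j = 0 := by
  classical
  simp_rw [Finset.mul_sum]
  rw [← Finset.sum_product']
  refine Finset.sum_involution (fun a _ => a.swap) (fun a _ => ?_) (fun a _ ha hs => ?_)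
    (fun _ _ => Finset.mem_univ _) fun _ _ => Prod.swap_swap _
  · simp only [Prod.fst_swap, Prod.snd_swap]
    rw [h a.2 a.1]
    ring
  · refine ha ?_
    have : a.1 = a.2 := congr_arg Prod.snd hs
    rw [this, h0, mul_zero, mul_zero]

lemma alternatingMap_cons_cons_swap {K M N : Type*} [Field K] [AddCommGroup M] [Module K M]
    [AddCommGroup N] [Module K N] {n : ℕ} (g : M [⋀^Fin (n + 2)]→ₗ[K] N) (d e : M)
    (v : Fin n → M) : g (Fin.cons d (Fin.cons e v)) = -g (Fin.cons e (Fin.cons d v)) := by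
  have h10 : (1 : Fin (n + 2)) = Fin.succ 0 := rfl
  rw [← g.map_swap _ (i := 0) (j := 1) (by rw [h10]; exact (Fin.succ_ne_zero 0).symm)]
  congr 1
  ext i
  induction i using Fin.cases with
  | zero => rw [Function.comp_apply, Equiv.swap_apply_left, h10]; rfl
  | succ i =>
    induction i using Fin.cases with
    | zero => rw [Function.comp_apply, ← h10, Equiv.swap_apply_right, h10]; rfl
    | succ i =>
      rw [Function.comp_apply, Equiv.swap_apply_of_ne_of_ne (Fin.succ_ne_zero _)
        (by rw [h10, Ne, Fin.succ_inj]; exact Fin.succ_ne_zero i)]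
      rfl

lemma alternatingMap_cons_cons_self {K M N : Type*} [Field K] [AddCommGroup M] [Module K M]
    [AddCommGroup N] [Module K N] {n : ℕ} (g : M [⋀^Fin (n + 2)]→ₗ[K] N) (d : M)
    (v : Fin n → M) : g (Fin.cons d (Fin.cons d v)) = 0 :=
  g.map_eq_zero_of_eq _ (i := 0) (j := Fin.succ 0) rfl (Fin.succ_ne_zero 0).symm

lemma alternatingMap_sum_apply {K M N ι κ : Type*} [Field K] [AddCommGroup M] [Module K M]
    [AddCommGroup N] [Module K N] (s : Finset ι) (f : ι → M [⋀^κ]→ₗ[K] N) (v : κ → M) :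
    (∑ i ∈ s, f i) v = ∑ i ∈ s, f i v :=
  map_sum (AddMonoidHom.mk' (fun g : M [⋀^κ]→ₗ[K] N => g v) fun _ _ => rfl) f s

section Koszul
variable {K : Type*} [Field K] {M : Type*} [AddCommGroup M] [Module K M] {S : Type*} [CommRing S]
  [Algebra K S] {ι : Type*} [Fintype ι]

/-- The Koszul differential of the sequence `x`, on alternating forms on the space with dual basis
`e`. -/
noncomputable def koszulForm (e : Basis ι K M) (x : ι → S) {n : ℕ}
    (B : (Dual K M) [⋀^Fin (n + 1)]→ₗ[K] S) : (Dual K M) [⋀^Fin n]→ₗ[K] S :=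
  ∑ i, (LinearMap.mulLeft K (x i)).compAlternatingMap (B.curryLeft (e.coord i))

variable (e : Basis ι K M) (x : ι → S)

lemma koszulForm_apply {n : ℕ} (B : (Dual K M) [⋀^Fin (n + 1)]→ₗ[K] S) (d : Fin n → Dual K M) :
    koszulForm e x B d = ∑ i, x i * B (Fin.cons (e.coord i) d) := by
  simp only [koszulForm, alternatingMap_sum_apply, LinearMap.compAlternatingMap_apply,
    AlternatingMap.curryLeft_apply_apply, LinearMap.mulLeft_apply, Matrix.vecCons]

lemma koszulForm_add {n : ℕ} (B C : (Dual K M) [⋀^Fin (n + 1)]→ₗ[K] S) :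
    koszulForm e x (B + C) = koszulForm e x B + koszulForm e x C := by
  ext d
  simp [koszulForm_apply, mul_add, Finset.sum_add_distrib]

lemma koszulForm_sub {n : ℕ} (B C : (Dual K M) [⋀^Fin (n + 1)]→ₗ[K] S) :
    koszulForm e x (B - C) = koszulForm e x B - koszulForm e x C := by
  ext d
  simp [koszulForm_apply, mul_sub, Finset.sum_sub_distrib]

lemma koszulForm_koszulForm {n : ℕ} (B : (Dual K M) [⋀^Fin (n + 2)]→ₗ[K] S) :
    koszulForm e x (koszulForm e x B) = 0 := by
  ext d
  simp only [koszulForm_apply, AlternatingMap.zero_apply]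
  exact sum_mul_mul_eq_zero x
    (fun i j => B (Fin.cons (e.coord j) (Fin.cons (e.coord i) d)))
    (fun i => alternatingMap_cons_cons_self _ _ _)
    (fun i j => alternatingMap_cons_cons_swap _ _ _ _)

/-- `δ` is an operator of division by the variable `x i`: a left inverse of the multiplication by
`x i` that commutes with the multiplication by the other variables. -/
structure IsDivision (x : ι → S) (i : ι) (δ : S →ₗ[K] S) : Prop where
  self : ∀ f, δ (x i * f) = f
  ne : ∀ j, j ≠ i → ∀ f, δ (x j * f) = x j * δ f

variable {e x}

/-- The homotopy `A ↦ e_i ∧ (A / x_i)` in the variable `x_i`: up to boundaries, a Koszul cycle can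
be changed so that it does not involve `e_i`, without spoiling this for the other variables. -/
lemma exists_koszulForm_sub_cons_eq_zero {S₁ S₂ : Submodule K S} {i : ι} {δ : S →ₗ[K] S}
    (hδ : IsDivision x i δ) (hδS : ∀ f ∈ S₂, δ f ∈ S₁) {n : ℕ}
    (A : (Dual K M) [⋀^Fin (n + 1)]→ₗ[K] S)
    (hAS : ∀ d, A d ∈ S₂) (hA : koszulForm e x A = 0) :
    ∃ T : (Dual K M) [⋀^Fin (n + 2)]→ₗ[K] S, (∀ d, T d ∈ S₁) ∧
      ∀ j, (j = i ∨ ∀ d, A (Fin.cons (e.coord j) d) = 0) →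
        ∀ d, (A - koszulForm e x T) (Fin.cons (e.coord j) d) = 0 := by
  classical
  let l : Dual K M →ₗ[K] S := Algebra.linearMap K S ∘ₗ Dual.eval K M (e i)
  have hl (j) : l (e.coord j) = if i = j then 1 else 0 := by
    by_cases h : i = j <;> simp [l, h]
  let E : S →ₗ[K] S := LinearMap.id - LinearMap.mulLeft K (x i) ∘ₗ δ
  let c := E.compAlternatingMap (A.curryLeft (e.coord i))
  let T := wedge l (δ.compAlternatingMap A)
  have hD : A - koszulForm e x T = E.compAlternatingMap A - wedge l c := by
    ext d
    -- division of the cycle condition by `x i`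
    have h1 (w) : ∑ j, x j * δ (A (Fin.cons (e.coord j) w)) = -c w := by
      have h2 := congr_arg δ (congr_arg (· w) hA)
      simp only [koszulForm_apply, AlternatingMap.zero_apply, map_zero, map_sum] at h2
      rw [← Finset.add_sum_erase _ _ (Finset.mem_univ i), hδ.self] at h2
      rw [← Finset.add_sum_erase _ _ (Finset.mem_univ i), ← Finset.sum_congr rfl fun j hj =>
        hδ.ne j (Finset.ne_of_mem_erase hj) _, eq_neg_of_add_eq_zero_right h2]
      simp [c, E, Matrix.vecCons, sub_eq_add_neg]
    have h3 : ∑ j, x j * wedge l (δ.compAlternatingMap (A.curryLeft (e.coord j))) d =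
        -wedge l c d := by
      simp only [wedge_apply, Finset.mul_sum]
      rw [Finset.sum_comm, ← Finset.sum_neg_distrib]
      refine Finset.sum_congr rfl fun m _ => ?_
      rw [← smul_neg, ← mul_neg, ← h1, Finset.mul_sum, Finset.smul_sum]
      refine Finset.sum_congr rfl fun j _ => ?_
      simp only [LinearMap.compAlternatingMap_apply, AlternatingMap.curryLeft_apply_apply,
        Matrix.vecCons, mul_smul_comm]
      rw [mul_left_comm]
    have h4 (j) : T (Fin.cons (e.coord j) d) = (if i = j then δ (A d) else 0) -
        wedge l (δ.compAlternatingMap (A.curryLeft (e.coord j))) d := by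
      simp only [T]
      rw [wedge_cons, hl]
      simp
    simp only [AlternatingMap.sub_apply, koszulForm_apply, h4, mul_sub, Finset.sum_sub_distrib, h3]
    simp [E]
    ring
  refine ⟨T, fun d => ?_, fun j hj d => ?_⟩
  · simp only [T, wedge_apply]
    refine Submodule.sum_mem _ fun m _ => ?_
    refine zsmul_mem ?_ _
    rw [show l (d m) = algebraMap K S (d m (e i)) from rfl, ← Algebra.smul_def]
    exact Submodule.smul_mem _ _ (hδS _ (hAS _))
  · rw [hD, AlternatingMap.sub_apply, wedge_cons_of_eq_zero, hl]
    · rcases hj with rfl | hj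
      · simp [c, Matrix.vecCons]
      · split_ifs with h
        · subst h
          simp [c, Matrix.vecCons]
        · simp [hj]
    · rintro w ⟨m, hm⟩
      have : A (Fin.cons (e.coord i) w) = 0 := by
        rcases hj with rfl | hj
        · exact A.map_eq_zero_of_eq _ (i := 0) (j := m.succ) (by simp [hm])
            (Fin.succ_ne_zero m).symm
        · exact alternatingMap_eq_zero_of_cons A hj (i := m.succ) (by simp [hm])
      simp [c, Matrix.vecCons, this]

/-- The Koszul complex of a sequence of variables is exact, except at its last term; the submodules
`S₁` and `S₂` keep track of the degrees. -/
lemma exists_koszulForm_eq {S₁ S₂ : Submodule K S}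
    (hx : ∀ i, ∀ f ∈ S₁, x i * f ∈ S₂) {δ : ι → S →ₗ[K] S} (hδ : ∀ i, IsDivision x i (δ i))
    (hδS : ∀ i, ∀ f ∈ S₂, δ i f ∈ S₁) {n : ℕ} (A : (Dual K M) [⋀^Fin (n + 1)]→ₗ[K] S)
    (hAS : ∀ d, A d ∈ S₂) (hA : koszulForm e x A = 0) :
    ∃ T : (Dual K M) [⋀^Fin (n + 2)]→ₗ[K] S, (∀ d, T d ∈ S₁) ∧ koszulForm e x T = A := by
  classical
  have key (s : Finset ι) : ∃ T : (Dual K M) [⋀^Fin (n + 2)]→ₗ[K] S, (∀ d, T d ∈ S₁) ∧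
      ∀ j ∈ s, ∀ d, (A - koszulForm e x T) (Fin.cons (e.coord j) d) = 0 := by
    induction s using Finset.induction with
    | empty => exact ⟨0, fun d => S₁.zero_mem, by simp⟩
    | insert i s _ ih =>
      obtain ⟨T, hT, hTs⟩ := ih
      obtain ⟨T', hT', hTs'⟩ := exists_koszulForm_sub_cons_eq_zero (hδ i) (hδS i)
        (A - koszulForm e x T) (fun d => S₂.sub_mem (hAS d) ((koszulForm_apply e x T d).symm ▸
          Submodule.sum_mem _ fun j _ => hx j _ (hT _)))
        (by rw [koszulForm_sub, koszulForm_koszulForm, hA, sub_zero])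
      refine ⟨T + T', fun d => S₁.add_mem (hT d) (hT' d), fun j hj d => ?_⟩
      rw [koszulForm_add, ← sub_sub]
      exact hTs' j ((Finset.mem_insert.1 hj).imp_right (hTs j)) d
  -- a form that involves none of the basis elements is zero
  obtain ⟨T, hT, h⟩ := key Finset.univ
  refine ⟨T, hT, (sub_eq_zero.1 ?_).symm⟩
  refine e.dualBasis.ext_alternating fun v _ => ?_
  have := h (v 0) (Finset.mem_univ _) fun i => e.dualBasis (v i.succ)
  rw [← e.coe_dualBasis] at this
  rw [AlternatingMap.zero_apply, ← this]
  congr 1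
  ext i : 1
  induction i using Fin.cases with
  | zero => simp
  | succ i => simp

end Koszul

section Division
variable {K : Type*} [Field K] {V : Type*} [AddCommGroup V] [Module K V]

/-- Division by a variable in the symmetric algebra, with remainder discarded; in particular `1`
goes to `0`. -/
lemma exists_isDivision_basis {κ : Type*} (b : Basis κ K V) (i : κ) :
    ∃ δ : SymmetricAlgebra K V →ₗ[K] SymmetricAlgebra K V,
      (∀ f, δ (SymmetricAlgebra.ι K V (b i) * f) = f) ∧
      (∀ j, j ≠ i → ∀ f, δ (SymmetricAlgebra.ι K V (b j) * f) =
        SymmetricAlgebra.ι K V (b j) * δ f) ∧ δ 1 = 0 := by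
  classical
  let E := SymmetricAlgebra.equivMvPolynomial b
  let δ₀ : MvPolynomial κ K →ₗ[K] MvPolynomial κ K :=
    { toFun := fun f => f.divMonomial (Finsupp.single i 1)
      map_add' := fun f g => MvPolynomial.add_divMonomial f g _
      map_smul' := fun c f => by
        ext m
        simp [MvPolynomial.coeff_divMonomial] }
  refine ⟨E.symm.toLinearMap ∘ₗ δ₀ ∘ₗ E.toLinearMap, fun f => ?_, fun j hj f => ?_, ?_⟩
  · simp [δ₀, E]
  · apply E.injective
    simp only [E, LinearMap.comp_apply, AlgEquiv.toLinearMap_apply, map_mul,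
      SymmetricAlgebra.equivMvPolynomial_ι_apply, AlgEquiv.apply_symm_apply]
    generalize SymmetricAlgebra.equivMvPolynomial b f = g
    ext m
    simp only [δ₀, LinearMap.coe_mk, AddHom.coe_mk, MvPolynomial.coeff_divMonomial,
      MvPolynomial.coeff_X_mul', Finsupp.mem_support_iff, Finsupp.add_apply]
    rw [Finsupp.single_eq_of_ne hj, zero_add]
    split_ifs with h
    · congr 1
      rw [add_tsub_assoc_of_le]
      simpa [Finsupp.single_le_iff, Nat.one_le_iff_ne_zero] using h
    · rfl
  · have h : δ₀ 1 = 0 := by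
      ext m
      have hm : (0 : κ →₀ ℕ) ≠ Finsupp.single i 1 + m := fun h => by
        have h1 := DFunLike.congr_fun h i
        simp only [Finsupp.zero_apply, Finsupp.add_apply, Finsupp.single_eq_same] at h1
        omega
      simp [δ₀, MvPolynomial.coeff_divMonomial, MvPolynomial.coeff_one, hm]
    simp [E, h]

/-- Linearly independent linear forms are part of a system of variables of the symmetric algebra, so
that there is a division by each of them, homogeneous of degree `-1`. -/
lemma exists_isDivision {ι : Type*} [Fintype ι] {v : ι → V} (hv : LinearIndependent K v) (i : ι) :
    ∃ δ : SymmetricAlgebra K V →ₗ[K] SymmetricAlgebra K V,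
      IsDivision (fun j => SymmetricAlgebra.ι K V (v j)) i δ ∧
      ∀ f ∈ forms K V 2, δ f ∈ forms K V 1 := by
  let b := Basis.extend hv.linearIndepOn_id
  have hmem (j) : v j ∈ hv.linearIndepOn_id.extend (Set.subset_univ (Set.range v)) :=
    LinearIndepOn.subset_extend _ _ ⟨j, rfl⟩
  have hb (j) : b ⟨v j, hmem j⟩ = v j := Basis.extend_apply_self _ _
  obtain ⟨δ, h1, h2, h3⟩ := exists_isDivision_basis b ⟨v i, hmem i⟩
  refine ⟨δ, ⟨fun f => ?_, fun j hj f => ?_⟩, fun f hf => ?_⟩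
  · simpa [hb] using h1 f
  · have := h2 ⟨v j, hmem j⟩ (fun h => hj (hv.injective (congr_arg Subtype.val h))) f
    simpa [hb] using this
  · have hspan : LinearMap.range (SymmetricAlgebra.ι K V) =
        Submodule.span K (Set.range fun k => SymmetricAlgebra.ι K V (b k)) := by
      rw [LinearMap.range_eq_map, ← b.span_eq, Submodule.map_span, ← Set.range_comp]
      rfl
    rw [forms, pow_two, hspan, Submodule.span_mul_span] at hf
    induction hf using Submodule.span_induction with
    | zero => rw [map_zero]; exact Submodule.zero_mem _
    | add f g _ _ hf hg => rw [map_add]; exact Submodule.add_mem _ hf hg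
    | smul c f _ hf => rw [map_smul]; exact Submodule.smul_mem _ c hf
    | mem f hf =>
      obtain ⟨_, ⟨k, rfl⟩, _, ⟨m, rfl⟩, rfl⟩ := hf
      by_cases hk : k = ⟨v i, hmem i⟩
      · simp only [hk, h1]
        exact mem_forms_one.2 ⟨_, rfl⟩
      · simp only [h2 k hk]
        rw [← mul_one (SymmetricAlgebra.ι K V (b m))]
        by_cases hm : m = ⟨v i, hmem i⟩
        · rw [hm, h1, mul_one]
          exact mem_forms_one.2 ⟨_, rfl⟩
        · rw [h2 m hm, h3, mul_zero, mul_zero]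
          exact Submodule.zero_mem _

end Division

/-! ### Contractions of an element of the top exterior power -/

section TopForm
variable {K : Type*} [Field K] {M : Type*} [AddCommGroup M] [Module K M]

/-- Contraction `Λ^m M^* → Λ^n M` of an element of `Λ^{m+n} M`. -/
noncomputable def contractTop {m n : ℕ} (o : ⋀[K]^(m + n) M) :
    ⋀[K]^m (Dual K M) →ₗ[K] ⋀[K]^n M :=
  exteriorPower.alternatingMapLinearEquiv (toForm (comul K M m n o))

@[simp]
lemma contractTop_ιMulti {m n : ℕ} (o : ⋀[K]^(m + n) M) (d : Fin m → Dual K M) :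
    contractTop o (exteriorPower.ιMulti K m d) = toForm (comul K M m n o) d := by
  simp [contractTop]

lemma exists_append_bijective {m n : ℕ} {f : Fin n → Fin (m + n)} (hf : Function.Injective f) :
    ∃ g : Fin m → Fin (m + n), Function.Bijective (Fin.append g f) := by
  classical
  have hc : Fintype.card {i // i ∉ Set.range f} = m := by
    rw [Fintype.card_subtype_compl]
    have : Fintype.card {x // x ∈ Set.range f} = n := by
      rw [← Fintype.card_congr (Equiv.ofInjective f hf), Fintype.card_fin]
    rw [this, Fintype.card_fin, Nat.add_sub_cancel]
  let g := (Fintype.equivFinOfCardEq hc).symm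
  refine ⟨fun i => g i, (Fin.append_injective_iff.2 ⟨?_, hf, ?_⟩).bijective_of_finite⟩
  · exact Subtype.val_injective.comp g.injective
  · intro i j h
    exact (g i).2 ⟨j, h.symm⟩

lemma append_comp {α β : Type*} {m n : ℕ} (h : α → β) (g : Fin m → α) (f : Fin n → α) :
    Fin.append (h ∘ g) (h ∘ f) = h ∘ Fin.append g f := by
  funext i
  refine Fin.addCases (fun i => ?_) (fun i => ?_) i <;> simp

/-- Contraction of an element of the top exterior power by the members of a basis. -/
lemma exists_contractTop_eq {m n : ℕ} {o : ⋀[K]^(m + n) M} (ho : o ≠ 0)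
    (e : Basis (Fin (m + n)) K M) {f : Fin n → Fin (m + n)} (hf : Function.Injective f) :
    ∃ ξ, contractTop o ξ = exteriorPower.ιMulti K n (e ∘ f) := by
  have := Module.Finite.of_basis e
  obtain ⟨g, hgf⟩ := exists_append_bijective hf
  let P (k : ℕ) (w : ⋀[K]^k M) : (Dual K M) [⋀^Fin k]→ₗ[K] K :=
    (LinearMap.applyₗ w).compAlternatingMap (exteriorPower.alternatingMapToDual K M k)
  have hP (k w d) : P k w d = exteriorPower.alternatingMapToDual K M k d w := rfl
  have hext {k : ℕ} {u w : ⋀[K]^k M} (h : ∀ v : Fin k → Fin (m + n), Function.Injective v →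
      P k u (e.dualBasis ∘ v) = P k w (e.dualBasis ∘ v)) : u = w := by
    have : P k u = P k w := e.dualBasis.ext_alternating h
    exact exteriorPower_ext fun d => DFunLike.congr_fun this d
  let c := P (m + n) o (e.dualBasis ∘ Fin.append g f)
  have hc : c ≠ 0 := by
    intro hc
    refine ho (hext fun v hv => ?_)
    obtain ⟨τ, hτ⟩ : ∃ τ : Equiv.Perm (Fin (m + n)), v = Fin.append g f ∘ τ :=
      ⟨(Equiv.ofBijective v hv.bijective_of_finite).trans (Equiv.ofBijective _ hgf).symm, by
        funext i
        exact ((Equiv.ofBijective _ hgf).apply_symm_apply (v i)).symm⟩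
    rw [hτ, ← Function.comp_assoc, AlternatingMap.map_perm]
    change _ • c = _
    rw [hc, smul_zero, hP, map_zero]
  have key : toForm (comul K M m n o) (e.dualBasis ∘ g) =
      c • exteriorPower.ιMulti K n (e ∘ f) := by
    refine hext fun v hv => ?_
    have hl (w : Fin n → Fin (m + n)) : P n (toForm (comul K M m n o) (e.dualBasis ∘ g))
        (e.dualBasis ∘ w) = P (m + n) o (e.dualBasis ∘ Fin.append g w) := by
      rw [hP, alternatingMapToDual_toForm_comul, append_comp, hP]
    have hr (w : Fin n → Fin (m + n)) : P n (c • exteriorPower.ιMulti K n (e ∘ f))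
        (e.dualBasis ∘ w) = c * Matrix.det (Matrix.of fun i j => e.coord (w j) (e (f i))) := by
      rw [hP, map_smul, exteriorPower.alternatingMapToDual_apply_ιMulti]
      simp
    by_cases hvf : ∀ i, ∃ j, f j = v i
    · choose τ hτ using hvf
      have hτ' : Function.Injective τ := fun i j h => hv (by rw [← hτ, ← hτ, h])
      have hv' : v = f ∘ Equiv.ofBijective τ hτ'.bijective_of_finite := by
        funext i
        exact (hτ i).symm
      rw [hv', ← Function.comp_assoc, AlternatingMap.map_perm, AlternatingMap.map_perm, hl, hr]
      have h1 : (Matrix.of fun i j => e.coord (f j) (e (f i))) = (1 : Matrix _ _ K) := by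
        ext i j
        simp [Matrix.one_apply, Finsupp.single_apply, hf.eq_iff]
      rw [h1, Matrix.det_one, mul_one]
    · push Not at hvf
      obtain ⟨i, hi⟩ := hvf
      obtain ⟨k, hk⟩ : ∃ k, g k = v i := by
        obtain ⟨k, hk⟩ := hgf.2 (v i)
        induction k using Fin.addCases with
        | left k => exact ⟨k, by simpa using hk⟩
        | right k => exact absurd (by simpa using hk) (hi k)
      rw [hl, hr, Matrix.det_eq_zero_of_column_eq_zero i fun j => by
        simp [Finsupp.single_apply, hi j], mul_zero]
      exact AlternatingMap.map_eq_zero_of_eq _ _ (i := Fin.castAdd n k) (j := Fin.natAdd m i)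
        (by simp [hk]) fun h => by
          have := congr_arg Fin.val h
          simp only [Fin.val_castAdd, Fin.val_natAdd] at this
          omega
  refine ⟨c⁻¹ • exteriorPower.ιMulti K m (e.dualBasis ∘ g), ?_⟩
  rw [map_smul, contractTop_ιMulti, key, smul_smul, inv_mul_cancel₀ hc, one_smul]

/-- A nonzero element of the top exterior power identifies `Λ^m M^*` with `Λ^n M`. -/
lemma contractTop_bijective [FiniteDimensional K M] {m n : ℕ} (hr : finrank K M = m + n)
    {o : ⋀[K]^(m + n) M} (ho : o ≠ 0) :
    Function.Bijective (contractTop o) := by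
  let e := finBasisOfFinrankEq K M hr
  have hs : Function.Surjective (contractTop o) := by
    rw [← LinearMap.range_eq_top, eq_top_iff,
      ← exteriorPower.ιMulti_span_of_span (R := K) (n := n) (M := M) e.span_eq, Submodule.span_le]
    rintro _ ⟨v, hv, rfl⟩
    choose f hf using fun i => hv (Set.mem_range_self i)
    obtain rfl : e ∘ f = v := funext hf
    by_cases hf : Function.Injective f
    · exact exists_contractTop_eq ho e hf
    · rw [AlternatingMap.map_eq_zero_of_not_injective]
      · exact Submodule.zero_mem _
      · exact fun h => hf h.of_comp
  refine ⟨(LinearMap.injective_iff_surjective_of_finrank_eq_finrank ?_).2 hs, hs⟩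
  rw [exteriorPower.finrank_eq, exteriorPower.finrank_eq, Subspace.dual_finrank_eq, hr,
    Nat.choose_symm_add]

lemma exists_exteriorPower_ne_zero [FiniteDimensional K M] {r : ℕ} (hr : finrank K M = r) :
    ∃ o : ⋀[K]^r M, o ≠ 0 := by
  have : Nontrivial (⋀[K]^r M) := Module.nontrivial_of_finrank_pos (R := K) (by
    rw [exteriorPower.finrank_eq, hr, Nat.choose_self]
    exact one_pos)
  exact exists_ne 0

end TopForm

section Cast
variable {K : Type*} [Field K] {M : Type*} [AddCommGroup M] [Module K M]

/-- Exterior powers of equal exponents agree. -/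
lemma exists_cast {m n : ℕ} (h : m = n) (o : ⋀[K]^m M) (ho : o ≠ 0) :
    ∃ o' : ⋀[K]^n M, o' ≠ 0 ∧ ∀ d : Fin n → Dual K M,
      exteriorPower.alternatingMapToDual K M n d o' =
        exteriorPower.alternatingMapToDual K M m (d ∘ Fin.cast h) o := by
  subst h
  exact ⟨o, ho, fun d => rfl⟩

/-- Coassociativity: the component of `Δ o` in `Λ^m ⊗ M ⊗ Λ^q`, computed in two ways. -/
lemma toHom_comulOne_toForm_comul [FiniteDimensional K M] {m q : ℕ} {o : ⋀[K]^(m + (q + 1)) M}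
    {o' : ⋀[K]^(m + 1 + q) M} {h : m + (q + 1) = m + 1 + q}
    (ho' : ∀ d : Fin (m + 1 + q) → Dual K M,
      exteriorPower.alternatingMapToDual K M _ d o' =
        exteriorPower.alternatingMapToDual K M _ (d ∘ Fin.cast h) o)
    (d : Fin m → Dual K M) (ε : Dual K M) :
    toHom (comulOne K M q (toForm (comul K M m (q + 1) o) d)) ε =
      toForm (comul K M (m + 1) q o') (Fin.snoc d ε : Fin (m + 1) → Dual K M) := by
  refine exteriorPower_ext fun c => ?_
  rw [alternatingMapToDual_toHom_comulOne, alternatingMapToDual_toForm_comul,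
    alternatingMapToDual_toForm_comul, ho', Fin.append_left_snoc]
  rfl

lemma alternatingMap_snoc {N : Type*} [AddCommGroup N] [Module K N] {n : ℕ}
    (g : M [⋀^Fin (n + 1)]→ₗ[K] N) (v : Fin n → M) (a : M) :
    g (Fin.snoc v a) = (-1 : K) ^ n • g (Fin.cons a v) := by
  rw [Fin.snoc_eq_cons_rotate]
  have := g.map_perm (Fin.cons a v) (finRotate (n + 1))
  rw [sign_finRotate, Nat.add_sub_cancel] at this
  refine this.trans ?_
  rcases neg_one_pow_eq_or K n with h | h <;> rcases Nat.even_or_odd n with h' | h' <;>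
    simp [h', Units.smul_def]

/-- An alternating map as a linear map of its first argument. -/
noncomputable def consLinear {N : Type*} [AddCommGroup N] [Module K N] {n : ℕ}
    (g : M [⋀^Fin (n + 1)]→ₗ[K] N) (v : Fin n → M) : M →ₗ[K] N where
  toFun a := g (Fin.cons a v)
  map_add' a b := g.map_vecCons_add v a b
  map_smul' c a := g.map_vecCons_smul v c a

@[simp]
lemma consLinear_apply {N : Type*} [AddCommGroup N] [Module K N] {n : ℕ}
    (g : M [⋀^Fin (n + 1)]→ₗ[K] N) (v : Fin n → M) (a : M) :
    consLinear g v a = g (Fin.cons a v) := rfl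

/-- Contraction with a dual pair of bases is natural. -/
lemma sum_mul_coord_comp {M' S ι κ : Type*} [Fintype ι] [Fintype κ] [AddCommGroup M']
    [Module K M'] [CommRing S] [Algebra K S] (e : Basis ι K M) (b : Basis κ K M')
    (g : M →ₗ[K] M') (h : M' →ₗ[K] S) (f : Dual K M →ₗ[K] S) :
    ∑ j, h (b j) * f (b.coord j ∘ₗ g) = ∑ i, h (g (e i)) * f (e.coord i) := by
  classical
  have h1 (j) : b.coord j ∘ₗ g = ∑ i, b.coord j (g (e i)) • e.coord i := by
    refine e.ext fun k => ?_
    simp [LinearMap.sum_apply, Finsupp.single_apply]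
  have h2 (i) : ∑ j, b.coord j (g (e i)) • h (b j) = h (g (e i)) := by
    simp_rw [← map_smul, ← map_sum, Basis.coord_apply, b.sum_repr]
  simp_rw [h1, map_sum, map_smul, ← h2, Finset.mul_sum, Finset.sum_mul]
  rw [Finset.sum_comm]
  simp_rw [mul_smul_comm, smul_mul_assoc]

/-- An alternating map that vanishes if one of its arguments lies in a subspace is not changed by
adding elements of that subspace to its arguments. -/
lemma alternatingMap_congr {N : Type*} [AddCommGroup N] [Module K N] {n : ℕ}
    (g : M [⋀^Fin n]→ₗ[K] N) (W : Submodule K M) (hg : ∀ v i, v i ∈ W → g v = 0)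
    {v w : Fin n → M} (h : ∀ i, v i - w i ∈ W) : g v = g w := by
  classical
  have key (s : Finset (Fin n)) : g (s.piecewise v w) = g w := by
    induction s using Finset.induction with
    | empty => simp
    | insert i s hi ih =>
      rw [Finset.piecewise_insert, ← sub_add_cancel (v i) (w i), AlternatingMap.map_update_add,
        hg _ i (by simpa using h i), zero_add, ← ih]
      congr 1
      rw [← Finset.piecewise_eq_of_notMem s v w hi, Function.update_eq_self]
  simpa using key Finset.univ

end Cast

/-! ### Generic syzygies and the projection -/

section MulMap
variable {K : Type*} [Field K] {M N A : Type*} [AddCommGroup M] [Module K M] [AddCommGroup N]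
  [Module K N] [CommRing A] [Algebra K A]

/-- The map `v ⊗ n ↦ l v * a n`. -/
noncomputable def mulMap (l : M →ₗ[K] A) (a : N →ₗ[K] A) : M ⊗[K] N →ₗ[K] A :=
  LinearMap.mul' K A ∘ₗ TensorProduct.map l a

lemma mulMap_apply {ι : Type*} [Fintype ι] (e : Basis ι K M) (l : M →ₗ[K] A) (a : N →ₗ[K] A)
    (t : M ⊗[K] N) : mulMap l a t = ∑ i, l (e i) * a (toHom t (e.coord i)) := by
  conv_lhs => rw [← sum_tmul_toHom_coord e t]
  simp [mulMap]

lemma apply_mulMap {B : Type*} [CommRing B] [Algebra K B] (f : A →ₐ[K] B) (l : M →ₗ[K] A)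
    (a : N →ₗ[K] A) (t : M ⊗[K] N) :
    f (mulMap l a t) = mulMap (f.toLinearMap ∘ₗ l) (f.toLinearMap ∘ₗ a) t := by
  induction t with
  | zero => simp
  | add s t hs ht => simp only [map_add, hs, ht]
  | tmul v n => simp [mulMap]

/-- The exterior product of linear and alternating forms, in terms of the comultiplication. -/
lemma wedge_eq_mulMap_comulOne {q : ℕ} (l : M →ₗ[K] A) (a : ⋀[K]^q M →ₗ[K] A)
    (v : Fin (q + 1) → M) :
    wedge l (a.compAlternatingMap (exteriorPower.ιMulti K q)) v =
      mulMap l a (comulOne K M q (exteriorPower.ιMulti K (q + 1) v)) := by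
  rw [wedge_apply]
  simp only [comulOne, exteriorPower.alternatingMapLinearEquiv_apply_ιMulti,
    AlternatingMap.alternatizeUncurryFin_apply, map_sum]
  refine Finset.sum_congr rfl fun i _ => ?_
  rw [map_zsmul]
  rfl

/-- The coefficients of the exterior product `l ∧ a` span the same space as its values. -/
lemma range_mulMap_comulOne {q : ℕ} (l : M →ₗ[K] A) (a : ⋀[K]^q M →ₗ[K] A) :
    LinearMap.range (mulMap l a ∘ₗ comulOne K M q) =
      Submodule.span K (Set.range
        (wedge l (a.compAlternatingMap (exteriorPower.ιMulti K q)))) := by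
  rw [LinearMap.range_eq_map, ← exteriorPower.ιMulti_span, Submodule.map_span, ← Set.range_comp]
  congr 2
  ext v
  exact (wedge_eq_mulMap_comulOne l a v).symm

end MulMap

section Generic
variable {K : Type*} [Field K] {L : Type*} [AddCommGroup L] [Module K L]

lemma mixedProduct_eq_mulMap (q : ℕ) : mixedProduct K L q =
    mulMap (SymmetricAlgebra.ι K (L × ⋀[K]^q L) ∘ₗ LinearMap.inl K L (⋀[K]^q L))
      (SymmetricAlgebra.ι K (L × ⋀[K]^q L) ∘ₗ LinearMap.inr K L (⋀[K]^q L)) := rfl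

lemma mixedProduct_comulOne_mem_quadrics [FiniteDimensional K L] (q : ℕ) (w : ⋀[K]^(q + 1) L) :
    mixedProduct K L q (comulOne K L q w) ∈ quadrics (gensyzIdeal K L q) := by
  refine ⟨?_, ?_⟩
  · have h : mixedProduct K L q (comulOne K L q w) ∈
        LinearMap.range (mixedProduct K L q ∘ₗ comulOne K L q) := ⟨w, rfl⟩
    rw [mixedProduct_eq_mulMap, range_mulMap_comulOne] at h
    exact (Submodule.span_le (p := (gensyzIdeal K L q).restrictScalars K)).2
      Ideal.subset_span h
  · rw [mixedProduct_eq_mulMap, mulMap_apply (finBasis K L)]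
    exact Submodule.sum_mem _ fun i _ => ι_mul_ι_mem_forms _ _

lemma toForm_genericSyzygy (p q : ℕ) (o : ⋀[K]^(p + (q + 1)) L)
    (d : Fin p → Dual K (L × ⋀[K]^q L)) :
    toForm (genericSyzygy K L p q o) d = mixedProduct K L q (comulOne K L q
      (toForm (comul K L p (q + 1) o) fun i => d i ∘ₗ LinearMap.inl K L (⋀[K]^q L))) :=
  toForm_map _ _ _ _

/-- The image of an orientation of `L` is a syzygy of the generic syzygy scheme: the Koszul
differential produces the products `e_i e_j` with skew-symmetric coefficients. -/
lemma genericSyzygy_mem_koszulSyzygies [FiniteDimensional K L] (p q : ℕ)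
    {o : ⋀[K]^(p + 1 + (q + 1)) L} (ho : o ≠ 0) :
    genericSyzygy K L (p + 1) q o ∈ koszulSyzygies (gensyzIdeal K L q) (p + 1) := by
  refine ⟨mem_range_lTensor_of_toForm_mem fun d => ?_, ?_⟩
  · rw [toForm_genericSyzygy]
    exact mixedProduct_comulOne_mem_quadrics q _
  · rw [SetLike.mem_coe, LinearMap.mem_ker]
    refine (toForm_bijective p).1 ?_
    ext d
    obtain ⟨o', -, ho'⟩ := exists_cast
      (show p + 1 + (q + 1) = p + 1 + 1 + q by omega) o ho
    let e := finBasis K L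
    let d' : Fin p → Dual K L := fun i => d i ∘ₗ LinearMap.inl K L (⋀[K]^q L)
    let f : Dual K L →ₗ[K] SymmetricAlgebra K (L × ⋀[K]^q L) :=
      (mixedProduct K L q ∘ₗ comulOne K L q) ∘ₗ
        consLinear (toForm (comul K L (p + 1) (q + 1) o)) d'
    have hf (ε : Dual K L) : f ε = mixedProduct K L q (comulOne K L q
        (toForm (comul K L (p + 1) (q + 1) o) (Fin.cons ε d'))) := rfl
    rw [toForm_koszulD (finBasis K (L × ⋀[K]^q L))]
    have h1 (j) : toForm (genericSyzygy K L (p + 1) q o)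
        (Fin.cons ((finBasis K (L × ⋀[K]^q L)).coord j) d) =
        f ((finBasis K (L × ⋀[K]^q L)).coord j ∘ₗ LinearMap.inl K L (⋀[K]^q L)) := by
      rw [toForm_genericSyzygy, hf]
      congr 4
      funext i
      induction i using Fin.cases <;> rfl
    simp_rw [h1]
    rw [sum_mul_coord_comp e]
    simp_rw [hf, mixedProduct_eq_mulMap, mulMap_apply e, toHom_comulOne_toForm_comul ho']
    rw [toForm_zero, AlternatingMap.zero_apply]
    simp only [LinearMap.comp_apply, alternatingMap_snoc]
    refine sum_mul_mul_eq_zero (fun i => SymmetricAlgebra.ι K _ (LinearMap.inl K L _ (e i))) _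
      (fun i => ?_) (fun i j => ?_)
    · rw [alternatingMap_cons_cons_self, smul_zero, map_zero, map_zero]
    · rw [alternatingMap_cons_cons_swap, smul_neg, map_neg, map_neg]

end Generic

section Projection
variable {K : Type*} [Field K] {V : Type*} [AddCommGroup V] [Module K V]

lemma symMap_ι {E : Type*} [AddCommGroup E] [Module K E] (f : E →ₗ[K] V) (v : E) :
    symMap f (SymmetricAlgebra.ι K E v) = SymmetricAlgebra.ι K V (f v) := by
  simp [symMap]

lemma symMap_comp_ι {E : Type*} [AddCommGroup E] [Module K E] (f : E →ₗ[K] V) :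
    (symMap f).toLinearMap ∘ₗ SymmetricAlgebra.ι K E = SymmetricAlgebra.ι K V ∘ₗ f :=
  LinearMap.ext (symMap_ι f)

/-- The cone over the linear section is the scheme obtained by the substitution `f`. -/
lemma coneOver_linearSection {E : Type*} [AddCommGroup E] [Module K E] (f : E →ₗ[K] V)
    (J : Ideal (SymmetricAlgebra K E)) :
    coneOver f (linearSection f J) = J.map (symMap f) := by
  rw [coneOver, linearSection, Ideal.map_mapₐ]
  congr 1
  ext v
  simp [symMap_ι]

/-- The alternating forms given by `σ` factor through the restriction of linear forms to `L`, if
`σ` involves only the elements of `L`. -/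
lemma toForm_eq_toForm_comp {L : Submodule K V} {p : ℕ}
    {σ : ⋀[K]^(p + 1) V ⊗[K] SymmetricAlgebra K V}
    (hL : ∀ d : Dual K V, (∀ v ∈ L, d v = 0) → ∀ w, toForm σ (Fin.cons d w) = 0)
    {d d' : Fin (p + 1) → Dual K V} (h : ∀ i, d i ∘ₗ L.subtype = d' i ∘ₗ L.subtype) :
    toForm σ d = toForm σ d' := by
  refine alternatingMap_congr _ L.dualAnnihilator (fun v i hi =>
    alternatingMap_eq_zero_of_cons _ (hL _ ((Submodule.mem_dualAnnihilator _).1 hi)) rfl)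
    fun i => (Submodule.mem_dualAnnihilator _).2 fun v hv => ?_
  exact sub_eq_zero.2 (LinearMap.congr_fun (h i) ⟨v, hv⟩)

/-- A Koszul syzygy that involves only the elements of `L` is a boundary in the Koszul complex of
`L`, hence the contraction of linear forms that depend on one more linear form on `L`. -/
lemma exists_toForm_eq_sum [FiniteDimensional K V] {L : Submodule K V} {p : ℕ}
    {σ : ⋀[K]^(p + 1) V ⊗[K] SymmetricAlgebra K V} (hσ : ∀ d, toForm σ d ∈ forms K V 2)
    (hσK : koszulD K V p σ = 0)
    (hL : ∀ d : Dual K V, (∀ v ∈ L, d v = 0) → ∀ w, toForm σ (Fin.cons d w) = 0) :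
    ∃ T : (Dual K L) [⋀^Fin (p + 1 + 1)]→ₗ[K] V, ∀ d : Fin (p + 1) → Dual K V,
      toForm σ d = ∑ i, SymmetricAlgebra.ι K V (finBasis K L i) * SymmetricAlgebra.ι K V
        (T (Fin.snoc (fun i => d i ∘ₗ L.subtype) ((finBasis K L).coord i))) := by
  let e := finBasis K L
  obtain ⟨ρ, hρ⟩ := L.subtype.exists_leftInverse_of_injective L.ker_subtype
  obtain ⟨j, hj⟩ := (SymmetricAlgebra.ι K V).exists_leftInverse_of_injective
    (LinearMap.ker_eq_bot.2 symmetricAlgebra_ι_injective)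
  let A : (Dual K L) [⋀^Fin (p + 1)]→ₗ[K] SymmetricAlgebra K V :=
    (toForm σ).compLinearMap ρ.dualMap
  have hA (d : Fin (p + 1) → Dual K V) : A (fun i => d i ∘ₗ L.subtype) = toForm σ d :=
    toForm_eq_toForm_comp hL fun i => by
      change ((d i ∘ₗ L.subtype) ∘ₗ ρ) ∘ₗ L.subtype = _
      rw [LinearMap.comp_assoc, hρ, LinearMap.comp_id]
  let x (i) := SymmetricAlgebra.ι K V (e i)
  have hAK : koszulForm e x A = 0 := by
    ext d
    have h1 : ∑ i, SymmetricAlgebra.ι K V (finBasis K V i) *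
        toForm σ (Fin.cons ((finBasis K V).coord i) fun i => d i ∘ₗ ρ) = 0 := by
      rw [← toForm_koszulD, hσK, toForm_zero, AlternatingMap.zero_apply]
    have h2 (i) : toForm σ (Fin.cons ((finBasis K V).coord i) fun i => d i ∘ₗ ρ) =
        consLinear A d ((finBasis K V).coord i ∘ₗ L.subtype) := by
      rw [consLinear_apply, ← hA]
      congr 1
      funext k
      induction k using Fin.cases with
      | zero => rfl
      | succ k =>
        change (d k ∘ₗ ρ) ∘ₗ L.subtype = d k
        rw [LinearMap.comp_assoc, hρ, LinearMap.comp_id]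
    simp_rw [h2] at h1
    rw [sum_mul_coord_comp e] at h1
    rw [koszulForm_apply, AlternatingMap.zero_apply, ← h1]
    rfl
  have hv : LinearIndependent K fun i => (e i : V) :=
    e.linearIndependent.map' L.subtype L.ker_subtype
  choose δ hδ hδS using exists_isDivision hv
  obtain ⟨T, hT1, hT⟩ := exists_koszulForm_eq (S₁ := forms K V 1) (S₂ := forms K V 2)
    (fun i f hf => by
      obtain ⟨v, rfl⟩ := mem_forms_one.1 hf
      exact ι_mul_ι_mem_forms _ _) hδ hδS A (fun d => hσ _) hAK
  -- the sign moves the additional argument from the first place to the last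
  refine ⟨(-1 : K) ^ (p + 1) • j.compAlternatingMap T, fun d => ?_⟩
  have hjT (w) : SymmetricAlgebra.ι K V (j (T w)) = T w := by
    obtain ⟨v, hv⟩ := mem_forms_one.1 (hT1 w)
    rw [← hv, show j _ = v from LinearMap.congr_fun hj v]
  rw [← hA, ← hT, koszulForm_apply]
  refine Finset.sum_congr rfl fun i _ => ?_
  rw [AlternatingMap.smul_apply, alternatingMap_snoc, smul_smul, ← mul_pow, neg_one_mul, neg_neg,
    one_pow, one_smul, LinearMap.compAlternatingMap_apply, hjT]

/-- The alternating forms of the image of a generic syzygy under `π^*`. -/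
lemma toForm_inducedMap_genericSyzygy {L : Type*} [AddCommGroup L] [Module K L] {p q : ℕ}
    (π : L × ⋀[K]^q L →ₗ[K] V) (o : ⋀[K]^(p + (q + 1)) L) (d : Fin p → Dual K V) :
    toForm (inducedMap π p (genericSyzygy K L p q o)) d =
      mulMap (SymmetricAlgebra.ι K V ∘ₗ π ∘ₗ LinearMap.inl K L (⋀[K]^q L))
        (SymmetricAlgebra.ι K V ∘ₗ π ∘ₗ LinearMap.inr K L (⋀[K]^q L))
        (comulOne K L q (toForm (comul K L p (q + 1) o)
          fun i => d i ∘ₗ π ∘ₗ LinearMap.inl K L (⋀[K]^q L))) := by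
  rw [inducedMap, toForm_map, toForm_genericSyzygy, mixedProduct_eq_mulMap,
    AlgHom.toLinearMap_apply, apply_mulMap, ← LinearMap.comp_assoc, ← LinearMap.comp_assoc,
    symMap_comp_ι]
  rfl

/-- By the perfect pairing between `Λ^{p+1} L` and `Λ^q L`, every contraction of an alternating
`(p + 1)`-form on `L^*` comes from a linear map on `Λ^q L`. -/
lemma exists_mulMap_comulOne_eq {L : Type*} [AddCommGroup L] [Module K L] [FiniteDimensional K L]
    {p q : ℕ} (hr : finrank K L = p + 1 + q) (T : (Dual K L) [⋀^Fin (p + 1)]→ₗ[K] V) :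
    ∃ o : ⋀[K]^(p + (q + 1)) L, o ≠ 0 ∧ ∃ a : ⋀[K]^q L →ₗ[K] V,
      ∀ (l : L →ₗ[K] SymmetricAlgebra K V) (d : Fin p → Dual K L),
        mulMap l (SymmetricAlgebra.ι K V ∘ₗ a)
            (comulOne K L q (toForm (comul K L p (q + 1) o) d)) =
          ∑ i, l (finBasis K L i) *
            SymmetricAlgebra.ι K V (T (Fin.snoc d ((finBasis K L).coord i))) := by
  have hq : p + (q + 1) = p + 1 + q := by omega
  obtain ⟨o, ho⟩ := exists_exteriorPower_ne_zero (hr.trans hq.symm)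
  obtain ⟨o', ho'0, ho'⟩ := exists_cast hq o ho
  obtain ⟨g, hg⟩ := (contractTop o').exists_leftInverse_of_injective
    (LinearMap.ker_eq_bot.2 (contractTop_bijective hr ho'0).1)
  have hga (ξ) : g (contractTop o' ξ) = ξ := LinearMap.congr_fun hg ξ
  refine ⟨o, ho, exteriorPower.alternatingMapLinearEquiv T ∘ₗ g, fun l d => ?_⟩
  rw [mulMap_apply (finBasis K L)]
  refine Finset.sum_congr rfl fun i _ => ?_
  rw [toHom_comulOne_toForm_comul ho', ← contractTop_ιMulti, LinearMap.comp_apply,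
    LinearMap.comp_apply, hga, exteriorPower.alternatingMapLinearEquiv_apply_ιMulti]

/-- The alternating forms of a nonzero syzygy that involves only the elements of `L` are those of
the image of a generic syzygy. -/
lemma exists_toForm_eq_mulMap [FiniteDimensional K V] {L : Submodule K V} {p : ℕ}
    {σ : ⋀[K]^(p + 1) V ⊗[K] SymmetricAlgebra K V} (hσ0 : σ ≠ 0)
    (hσ : ∀ d, toForm σ d ∈ forms K V 2) (hσK : koszulD K V p σ = 0)
    (hL : ∀ d : Dual K V, (∀ v ∈ L, d v = 0) → ∀ w, toForm σ (Fin.cons d w) = 0) :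
    ∃ q : ℕ, finrank K L = p + 1 + 1 + q ∧ ∃ o : ⋀[K]^(p + 1 + (q + 1)) L, o ≠ 0 ∧
      ∃ a : ⋀[K]^q L →ₗ[K] V, ∀ d, toForm σ d =
        mulMap (SymmetricAlgebra.ι K V ∘ₗ L.subtype) (SymmetricAlgebra.ι K V ∘ₗ a)
          (comulOne K L q (toForm (comul K L (p + 1) (q + 1) o) fun i => d i ∘ₗ L.subtype)) := by
  obtain ⟨T, hT⟩ := exists_toForm_eq_sum hσ hσK hL
  -- otherwise every alternating form of degree `p + 2` on the dual of `L` is zero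
  have hr : p + 1 + 1 ≤ finrank K L := by
    by_contra hr
    refine hσ0 ((toForm_bijective (p + 1)).1 ?_)
    ext d
    have hT0 (w) : T w = 0 :=
      T.map_linearDependent w fun hw => hr ((Fintype.card_fin _).symm.trans_le
        hw.fintype_card_le_finrank |>.trans_eq Subspace.dual_finrank_eq)
    simp only [hT, hT0, map_zero, mul_zero, Finset.sum_const_zero, toForm_zero,
      AlternatingMap.zero_apply]
  obtain ⟨q, hq⟩ := Nat.exists_eq_add_of_le hr
  obtain ⟨o, ho, a, ha⟩ := exists_mulMap_comulOne_eq hq T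
  refine ⟨q, hq, o, ho, a, fun d => ?_⟩
  rw [ha, hT]
  rfl

/-- If the alternating form of `σ` is given by `l ∧ a` and the contractions of the orientation `o`
of `L`, then the coefficients of `σ` span the same space as those of `l ∧ a`, because every
element of `Λ^{q+1} L` is a contraction of `o`. -/
lemma range_toHom_eq_range_mulMap [FiniteDimensional K V] {L : Submodule K V} {p q : ℕ}
    (hr : finrank K L = p + (q + 1)) {o : ⋀[K]^(p + (q + 1)) L} (ho : o ≠ 0)
    {σ : ⋀[K]^p V ⊗[K] SymmetricAlgebra K V} (l : L →ₗ[K] SymmetricAlgebra K V)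
    (a : ⋀[K]^q L →ₗ[K] SymmetricAlgebra K V)
    (h : ∀ d, toForm σ d = mulMap l a
      (comulOne K L q (toForm (comul K L p (q + 1) o) fun i => d i ∘ₗ L.subtype))) :
    LinearMap.range (toHom σ) = LinearMap.range (mulMap l a ∘ₗ comulOne K L q) := by
  have h1 : toHom σ ∘ₗ exteriorPower.pairingDual K V p =
      (mulMap l a ∘ₗ comulOne K L q) ∘ₗ contractTop o ∘ₗ
        exteriorPower.map p L.subtype.dualMap := by
    rw [toHom_comp_pairingDual]
    refine exteriorPower.linearMap_ext ?_
    ext d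
    simp only [LinearMap.compAlternatingMap_apply, LinearMap.comp_apply,
      exteriorPower.alternatingMapLinearEquiv_apply_ιMulti, exteriorPower.map_apply_ιMulti,
      contractTop_ιMulti, h]
    rfl
  have h2 : Function.Surjective (exteriorPower.map p L.subtype.dualMap) :=
    exteriorPower.map_surjective (LinearMap.dualMap_surjective_of_injective L.injective_subtype)
  rw [← LinearMap.range_comp_of_range_eq_top (toHom σ)
    (LinearMap.range_eq_top.2 (pairingDual_bijective p).2), h1,
    LinearMap.range_comp_of_range_eq_top]
  rw [LinearMap.range_eq_top, LinearMap.coe_comp]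
  exact (contractTop_bijective hr ho).2.comp h2

/-- The ideal of the cone over the linear section of the generic syzygy scheme by the projection
with components `l` and `a` is generated by the coefficients of `l ∧ a`. -/
lemma coneOver_gensyzIdeal {L : Type*} [AddCommGroup L] [Module K L] {q : ℕ} (l : L →ₗ[K] V)
    (a : ⋀[K]^q L →ₗ[K] V) :
    coneOver (l.coprod a) (linearSection (l.coprod a) (gensyzIdeal K L q)) =
      Ideal.span (LinearMap.range (mulMap (SymmetricAlgebra.ι K V ∘ₗ l)
        (SymmetricAlgebra.ι K V ∘ₗ a) ∘ₗ comulOne K L q)) := by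
  have h (v : Fin (q + 1) → L) : symMap (l.coprod a) (wedge
        (SymmetricAlgebra.ι K (L × ⋀[K]^q L) ∘ₗ LinearMap.inl K L (⋀[K]^q L))
        ((SymmetricAlgebra.ι K (L × ⋀[K]^q L) ∘ₗ
          LinearMap.inr K L (⋀[K]^q L)).compAlternatingMap (exteriorPower.ιMulti K q)) v) =
      wedge (SymmetricAlgebra.ι K V ∘ₗ l)
        ((SymmetricAlgebra.ι K V ∘ₗ a).compAlternatingMap (exteriorPower.ιMulti K q)) v := by
    rw [wedge_eq_mulMap_comulOne, apply_mulMap, wedge_eq_mulMap_comulOne, ← LinearMap.comp_assoc,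
      ← LinearMap.comp_assoc, symMap_comp_ι, LinearMap.comp_assoc, LinearMap.comp_assoc,
      LinearMap.coprod_inl, LinearMap.coprod_inr]
  rw [coneOver_linearSection, gensyzIdeal, Ideal.map_span, ← Set.range_comp,
    range_mulMap_comulOne]
  refine Eq.trans ?_ (Submodule.span_span_of_tower K _ _).symm
  exact congr_arg Ideal.span (congr_arg Set.range (funext h))

/-- A linear functional is a point of the scheme defined by the coefficients of `l ∧ a` if and only
if it maps `l` and `a` to forms with exterior product zero. -/
lemma forall_mem_span_range_mulMap_iff {L : Type*} [AddCommGroup L] [Module K L] {q : ℕ}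
    (l : L →ₗ[K] V) (a : ⋀[K]^q L →ₗ[K] V) (x : Dual K V) :
    (∀ Q ∈ Ideal.span (LinearMap.range (mulMap (SymmetricAlgebra.ι K V ∘ₗ l)
        (SymmetricAlgebra.ι K V ∘ₗ a) ∘ₗ comulOne K L q) : Set (SymmetricAlgebra K V)),
        SymmetricAlgebra.lift x Q = 0) ↔
      wedge (x ∘ₗ l) ((x ∘ₗ a).compAlternatingMap (exteriorPower.ιMulti K q)) = 0 := by
  have h (w) : SymmetricAlgebra.lift x (mulMap (SymmetricAlgebra.ι K V ∘ₗ l)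
      (SymmetricAlgebra.ι K V ∘ₗ a) (comulOne K L q w)) =
      mulMap (x ∘ₗ l) (x ∘ₗ a) (comulOne K L q w) := by
    have hx : (SymmetricAlgebra.lift x).toLinearMap ∘ₗ SymmetricAlgebra.ι K V = x :=
      LinearMap.ext fun v => SymmetricAlgebra.lift_ι_apply x v
    rw [apply_mulMap, ← LinearMap.comp_assoc, ← LinearMap.comp_assoc, hx]
  constructor
  · intro hx
    ext v
    rw [wedge_eq_mulMap_comulOne, ← h]
    exact hx _ (Ideal.subset_span ⟨_, rfl⟩)
  · intro hx Q hQ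
    refine (Ideal.span_le (I := RingHom.ker (SymmetricAlgebra.lift x))).2 ?_ hQ
    rintro _ ⟨w, rfl⟩
    rw [SetLike.mem_coe, RingHom.mem_ker, LinearMap.comp_apply, h]
    have h0 : mulMap (x ∘ₗ l) (x ∘ₗ a) ∘ₗ comulOne K L q = 0 := by
      refine exteriorPower.linearMap_ext ?_
      ext v
      exact (wedge_eq_mulMap_comulOne _ _ v).symm.trans (DFunLike.congr_fun hx v)
    exact LinearMap.congr_fun h0 w

end Projection

end LinearSyzygy

theorem mainTheorem3 {K : Type*} [Field K] {V : Type*} [AddCommGroup V] [Module K V]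
    [FiniteDimensional K V] (I : Ideal (SymmetricAlgebra K V)) (hI : GeneratedByQuadrics I)
    (F : MinimalResolution I) (p : ℕ) (hp : 1 ≤ p) (s : F.Strand p) (hs : s ≠ 0) :
    ∃ σ ∈ koszulSyzygies I p, F.Corresponds p s σ ∧
      ∃ q : ℕ, Module.finrank K (F.involvedForms p s) = p + 1 + q ∧
        ∃ π : F.involvedForms p s × ⋀[K]^q (F.involvedForms p s) →ₗ[K] V,
          (∃ g, IsGenericSyzygy (p := p) (q := q) (K := K) (L := F.involvedForms p s) g ∧
            σ = inducedMap π p g) ∧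
          syzIdeal σ =
            coneOver π (linearSection π (gensyzIdeal K (F.involvedForms p s) q)) ∧
          ∀ x : Module.Dual K V, (∀ Q ∈ syzIdeal σ, SymmetricAlgebra.lift x Q = 0) ↔
            (x ∘ₗ π ∘ₗ LinearMap.inl K _ _,
              (x ∘ₗ π ∘ₗ LinearMap.inr K _ _).compAlternatingMap (exteriorPower.ιMulti K q)) ∈
              gensyzPoints K (F.involvedForms p s) q := by
  cases p with
  | zero => exact absurd hp (by decide)
  | succ p =>
    have h1 := F.exists_corresponds hI hs
    choose σ hσ hsσ hσ0 hL using h1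
    have h2 := exists_toForm_eq_mulMap hσ0
      (fun d => (toForm_mem_of_mem_range_lTensor hσ.1 d).2) hσ.2 hL
    choose q hq o ho a ha using h2
    have hinl : (F.involvedForms (p + 1) s).subtype.coprod a ∘ₗ LinearMap.inl K _ _ =
      (F.involvedForms (p + 1) s).subtype := LinearMap.coprod_inl _ _
    have hinr : (F.involvedForms (p + 1) s).subtype.coprod a ∘ₗ LinearMap.inr K _ _ = a :=
      LinearMap.coprod_inr _ _
    have hideal : syzIdeal σ = Ideal.span (LinearMap.range (mulMap
        (SymmetricAlgebra.ι K V ∘ₗ (F.involvedForms (p + 1) s).subtype)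
        (SymmetricAlgebra.ι K V ∘ₗ a) ∘ₗ comulOne K _ q)) := by
      rw [syzIdeal, range_toHom_eq_range_mulMap (hq.trans (by omega)) ho _ _ ha]
    refine ⟨σ, hσ, hsσ, q, hq, (F.involvedForms (p + 1) s).subtype.coprod a,
      ⟨genericSyzygy K _ (p + 1) q o,
        ⟨genericSyzygy_mem_koszulSyzygies p q ho, o, ho, rfl⟩, ?_⟩, ?_, fun x => ?_⟩
    · apply (toForm_bijective (K := K) (M := V) (N := SymmetricAlgebra K V) (p + 1)).1
      ext d
      rw [toForm_inducedMap_genericSyzygy, hinl, hinr, ha]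
    · rw [coneOver_gensyzIdeal, hideal]
    · rw [hideal, forall_mem_span_range_mulMap_iff, hinl, hinr]
      rfl
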